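/- All graphs are finite and simple. For a graph $G$, let $\gamma(G)$ be the minimum cardinality of a dominating set of $G$, and let the bondage number $b(G)$ be the minimum cardinality of a set $A\subseteq E(G)$ with $\gamma(G-A)=\gamma(G)+1$ (with $b(G)=\infty$ if there is no such set, i.e. if $G$ has no edges). For a fixed integer $d$, $d$-Bondage is the problem of deciding, given a graph $G$, whether $b(G)\le d$. Dominating Set is the problem of deciding, given a graph $G$ and an integer $k\ge 1$, whether $\gamma(G)\le k$. A problem can be solved in polynomial time for a class $\mathcal{C}$ of graphs if some deterministic Turing machine, on every instance whose graph lies in $\mathcal{C}$, gives the correct answer in time polynomial in the length of the instance; graphs are encoded by adjacency matrices and integers in binary. A graph is $H$-free if it has no induced subgraph isomorphic to $H$; $\delta(H)$ is the minimum degree of $H$. **Proposition.** Let $d\ge 1$ be a fixed integer and let $\mathcal{C}$ be a class of graphs. Then $d$-Bondage can be solved in polynomial time for $\mathcal{C}$ if at least one of the following holds: 1. $\mathcal{C}$ is closed under edge deletions (that is, $G-e\in\mathcal{C}$ for every $G\in\mathcal{C}$ and $e\in E(G)$), and Dominating Set can be solved in polynomial time for $\mathcal{C}$; 2. $\mathcal{C}$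 is the class of $H$-free graphs for some fixed graph $H$ with $\delta(H)\ge 2$, and Dominating Set can be solved in polynomial time for $\mathcal{C}$; 3. there is a constant $k$ such that $\gamma(G)\le k$ for every $G\in\mathcal{C}$. -/

import Mathlib

namespace Bondage

/-- `S` is a dominating set: every vertex lies in `S` or has a neighbour in `S`. -/
def IsDominating {V : Type*} (G : SimpleGraph V) (S : Finset V) : Prop :=
  ∀ v, v ∈ S ∨ ∃ u ∈ S, G.Adj v u

/-- The domination number `γ(G)`: the least cardinality of a dominating set. The set below is
nonempty, because the set of all vertices is dominating. -/
noncomputable def dominationNumber {V : Type*} [Fintype V] (G : SimpleGraph V) : ℕ :=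
  sInf {m : ℕ | ∃ S : Finset V, IsDominating G S ∧ S.card = m}

/-- The bondage number `b(G)`: the least cardinality of a set `A` of edges of `G` with
`γ(G - A) = γ(G) + 1`. It is `⊤` when there is no such set, that is, when `G` has no edge. -/
noncomputable def bondageNumber {V : Type*} [Fintype V] (G : SimpleGraph V) : ℕ∞ :=
  sInf {m : ℕ∞ | ∃ A : Finset (Sym2 V), (A : Set (Sym2 V)) ⊆ G.edgeSet ∧
    dominationNumber (G.deleteEdges (A : Set (Sym2 V))) = dominationNumber G + 1 ∧
    (A.card : ℕ∞) = m}

/-- Finite simple graphs, presented on the vertex sets `{0, …, n - 1}`. -/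
abbrev FinGraph : Type := Σ n : ℕ, SimpleGraph (Fin n)

open Computability in
open scoped Classical in
/-- The adjacency matrix of a graph, written row by row; every row is followed by a comma. -/
noncomputable def encodeGraph (G : FinGraph) : List Γ' :=
  (List.finRange G.1).flatMap fun i =>
    (List.finRange G.1).map (fun j => Γ'.bit (decide (G.2.Adj i j))) ++ [Γ'.comma]

open Computability in
/-- A graph together with a natural number: the code of the graph, a separator, and the binary
expansion of the number. -/
noncomputable def encodeGraphNat (x : FinGraph × ℕ) : List Γ' :=
  encodeGraph x.1 ++ Γ'.ket :: (encodeNat x.2).map Γ'.bit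

open scoped Classical in
/-- The decision problem `P` can be solved in polynomial time on the instances in `I`: there are a
multi-stack Turing machine and a polynomial `p` such that, on the code `w` of any instance in `I`,
the machine halts within `p(|w|)` steps and outputs whether `P` holds. Nothing is required of the
machine on other inputs. -/
def SolvableInPolyTimeOn {α Γ : Type} (encode : α → List Γ) (I : Set α) (P : α → Prop) : Prop :=
  Nonempty (Turing.TM2ComputableInPolyTime (fun a : I => encode a) Computability.encodeBool
    (fun a : I => decide (P a)))

/-- Dominating Set can be solved in polynomial time for the class `C`: given `G ∈ C` and an
integer `k ≥ 1`, decide whether `γ(G) ≤ k`. -/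
def DominatingSetPoly (C : Set FinGraph) : Prop :=
  SolvableInPolyTimeOn encodeGraphNat {x | x.1 ∈ C ∧ 1 ≤ x.2}
    fun x => dominationNumber x.1.2 ≤ x.2

/-- `d`-Bondage can be solved in polynomial time for the class `C`: given `G ∈ C`, decide whether
`b(G) ≤ d`. -/
def BondagePoly (d : ℕ) (C : Set FinGraph) : Prop :=
  SolvableInPolyTimeOn encodeGraph C fun G => bondageNumber G.2 ≤ (d : ℕ∞)

/-- `C` is closed under edge deletions: if `G ∈ C` and `e ∈ E(G)`, then `G - e ∈ C`. -/
def ClosedUnderEdgeDeletions (C : Set FinGraph) : Prop :=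
  ∀ (n : ℕ) (G : SimpleGraph (Fin n)), (⟨n, G⟩ : FinGraph) ∈ C →
    ∀ e ∈ G.edgeSet, (⟨n, G.deleteEdges {e}⟩ : FinGraph) ∈ C

/-- The class of `H`-free graphs: those without an induced subgraph isomorphic to `H`. -/
def HFree {W : Type} (H : SimpleGraph W) : Set FinGraph :=
  {G | ¬ H.IsIndContained G.2}

end Bondage

/-! Graph theory. Deleting one edge raises `γ` by at most one, so `b(G) ≤ d` means that deleting
some at most `d` edges raises `γ` at all (`bondageNumber_le_iff`). Such edge sets are described by
`2d`-tuples `e` of vertices, read as `d` pairs; pairs that are not edges do no harm. Hence `b(G) ≤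
d` iff `γ(G) < γ(cut G e)` for some `e`, and as `d` is fixed there are only polynomially many `e`.
The strict inequality is witnessed by an integer `r` with `γ(G) ≤ r` and not `γ(cut G e) ≤ r`
(`bondagePoly_of_evaluable`). It remains to decide both bounds. If the class is closed under edge
deletions, it contains `cut G e`, and the Dominating Set machine answers. For `H`-free graphs `cut G
e` may leave the class. Instead guess, for each `e l`, a vertex `f l` that dominates it in `cut G
e`, and force `f l` into the dominating set by attaching a pendant vertex to it in `G`
(`dominationNumber_cut_le_iff`); if `δ(H) ≥ 2`, pendant vertices create no induced `H`
(`isIndContained_of_pendant`). If `γ` is bounded by a constant, all candidate dominating sets of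
bounded size can be tried. Machines. Programs are composed from fragments by sequencing, branching
and looping, with time bounds, and may call a given machine as a subroutine. On top of this,
`Evaluable` and `Emittable` form a small calculus: properties decidable in polynomial time are
closed under Boolean connectives, quantification over vertices and queries about graphs whose
adjacency is itself evaluable. The algorithms are then just formulas. -/

namespace Bondage

open Turing Turing.TM2 Computability Function

/-! ### Structured programs for multi-stack machines. -/

section Fragments

variable {K : Type} [DecidableEq K] {Γ : K → Type} {Λ Λ' σ : Type}

/-- A fragment of a multi-stack machine. The local store is extended by a buffer for one symbol,
which is empty whenever control enters or leaves a fragment. Halting means leaving the fragment. -/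
structure Fragment (Γ : K → Type) (σ : Type) where
  Label : Type
  fin : Fintype Label
  entry : Label
  code : Label → Stmt Γ Label (σ × Option Γ')

/-- `Steps m t c c'`: the program `m` leads from `c` to `c'` in exactly `t` steps. -/
inductive Steps (m : Λ → Stmt Γ Λ σ) : ℕ → Cfg Γ Λ σ → Cfg Γ Λ σ → Prop
  | refl (c) : Steps m 0 c c
  | head {t l v S c} : Steps m t (stepAux (m l) v S) c → Steps m (t + 1) ⟨some l, v, S⟩ c

theorem Steps.trans {m : Λ → Stmt Γ Λ σ} {t t' : ℕ} {a b c : Cfg Γ Λ σ}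
    (h : Steps m t a b) (h' : Steps m t' b c) : Steps m (t + t') a c := by
  induction h with
  | refl => simpa using h'
  | head _ ih => rw [Nat.add_right_comm]; exact .head (ih h')

/-- `Exec M (v, S) (v', S') T`: entered with store `v` and stacks `S`, the fragment `M` is left
with store `v'` and stacks `S'` after at most `T` steps. -/
def Exec (M : Fragment Γ σ) (s s' : σ × ∀ k, List (Γ k)) (T : ℕ) : Prop :=
  ∃ t ≤ T, Steps M.code t ⟨some M.entry, (s.1, none), s.2⟩ ⟨none, (s'.1, none), s'.2⟩

theorem Exec.mono {M : Fragment Γ σ} {s s' : σ × ∀ k, List (Γ k)} {T T' : ℕ}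
    (h : Exec M s s' T) (hT : T ≤ T') : Exec M s s' T' :=
  let ⟨t, ht, hs⟩ := h; ⟨t, ht.trans hT, hs⟩

/-- Rename the labels of a statement by `f`, and replace halting by a jump to `e`, if any. -/
def relabel (f : Λ → Λ') (e : Option Λ') : Stmt Γ Λ σ → Stmt Γ Λ' σ
  | .push k g q => .push k g (relabel f e q)
  | .peek k g q => .peek k g (relabel f e q)
  | .pop k g q => .pop k g (relabel f e q)
  | .load g q => .load g (relabel f e q)
  | .branch b q₁ q₂ => .branch b (relabel f e q₁) (relabel f e q₂)
  | .goto g => .goto (f ∘ g)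
  | .halt => e.elim .halt fun l => .goto fun _ => l

theorem stepAux_relabel (f : Λ → Λ') (e : Option Λ') (q : Stmt Γ Λ σ) (v : σ)
    (S : ∀ k, List (Γ k)) : stepAux (relabel f e q) v S =
      ⟨(stepAux q v S).l.elim e (some ∘ f), (stepAux q v S).var, (stepAux q v S).stk⟩ := by
  induction q generalizing v S with
  | push k g q ih => simp [relabel, ih]
  | peek k g q ih => simp [relabel, ih]
  | pop k g q ih => simp [relabel, ih]
  | load g q ih => simp [relabel, ih]
  | branch b q₁ q₂ ih₁ ih₂ => cases h : b v <;> simp [relabel, ih₁, ih₂, h]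
  | goto g => simp [relabel]
  | halt => cases e <;> simp [relabel]

/-- The compositionality principle: a halting run of a component is also a run of the whole program,
ending at the label `e` that replaces halting. -/
theorem Steps.relabel {m : Λ → Stmt Γ Λ σ} {m' : Λ' → Stmt Γ Λ' σ} {f : Λ → Λ'} {e : Option Λ'}
    (hm : ∀ l, m' (f l) = relabel f e (m l)) {t : ℕ} {l : Λ} {v v' : σ} {S S' : ∀ k, List (Γ k)}
    (h : Steps m t ⟨some l, v, S⟩ ⟨none, v', S'⟩) :
    Steps m' t ⟨some (f l), v, S⟩ ⟨e, v', S'⟩ := by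
  induction t generalizing l v S with
  | zero => cases h
  | succ t ih =>
    obtain _ | h := h
    refine .head ?_
    rw [hm, stepAux_relabel]
    rcases hc : stepAux (m l) v S with ⟨_ | l', w, R⟩
    · rw [hc] at h
      cases h
      exact .refl _
    · rw [hc] at h
      exact ih h

/-- The fragment that executes one statement. -/
def basic (q : Stmt Γ Unit (σ × Option Γ')) : Fragment Γ σ := ⟨Unit, inferInstance, (), fun _ => q⟩

theorem exec_basic {q : Stmt Γ Unit (σ × Option Γ')} {s s' : σ × ∀ k, List (Γ k)}
    (h : stepAux q (s.1, none) s.2 = ⟨none, (s'.1, none), s'.2⟩) : Exec (basic q) s s' 1 :=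
  ⟨1, le_rfl, .head (by simpa [basic, h] using Steps.refl _)⟩

/-- Sequential composition. -/
def seq (M N : Fragment Γ σ) : Fragment Γ σ where
  Label := M.Label ⊕ N.Label
  fin := haveI := M.fin; haveI := N.fin; inferInstance
  entry := .inl M.entry
  code := Sum.elim (fun l => relabel .inl (some (.inr N.entry)) (M.code l))
    fun l => relabel .inr none (N.code l)

infixr:60 " ;; " => seq

theorem Exec.seq {M N : Fragment Γ σ} {s s' s'' : σ × ∀ k, List (Γ k)} {T T' : ℕ}
    (h : Exec M s s' T) (h' : Exec N s' s'' T') : Exec (M ;; N) s s'' (T + T') := by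
  obtain ⟨t, ht, h⟩ := h
  obtain ⟨t', ht', h'⟩ := h'
  exact ⟨t + t', add_le_add ht ht', (h.relabel (m' := (M ;; N).code) fun _ => rfl).trans
    (h'.relabel (f := Sum.inr) fun _ => rfl)⟩

/-- Evaluate the test `p` on the store and the top of the stack `k`, and branch. -/
def testStmt (k : K) (p : σ → Option (Γ k) → Bool) (l l' : Option Λ) :
    Stmt Γ Λ (σ × Option Γ') :=
  -- A branch sees only the local store, so the outcome of the test is kept in the buffer and erased
  -- in both branches.
  .peek k (fun v o => (v.1, if p v.1 o then some .blank else none)) <|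
    .branch (fun v => v.2.isSome)
      (.load (fun v => (v.1, none)) (l.elim .halt fun l => .goto fun _ => l))
      (.load (fun v => (v.1, none)) (l'.elim .halt fun l => .goto fun _ => l))

theorem stepAux_testStmt (k : K) (p : σ → Option (Γ k) → Bool) (l l' : Option Λ) (v : σ)
    (S : ∀ k, List (Γ k)) : stepAux (testStmt k p l l') (v, none) S =
      ⟨if p v (S k).head? then l else l', (v, none), S⟩ := by
  cases h : p v (S k).head? <;> cases l <;> cases l' <;> simp [testStmt, h]

/-- Conditional. -/
def ite (k : K) (p : σ → Option (Γ k) → Bool) (M N : Fragment Γ σ) : Fragment Γ σ where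
  Label := Option (M.Label ⊕ N.Label)
  fin := haveI := M.fin; haveI := N.fin; inferInstance
  entry := none
  code l := l.elim (testStmt k p (some (some (.inl M.entry))) (some (some (.inr N.entry)))) <|
    Sum.elim (fun l => relabel (fun l => some (.inl l)) none (M.code l))
      fun l => relabel (fun l => some (.inr l)) none (N.code l)

theorem exec_ite {k : K} {p : σ → Option (Γ k) → Bool} {M N : Fragment Γ σ}
    {s s' : σ × ∀ k, List (Γ k)} {T : ℕ}
    (h : p s.1 (s.2 k).head? = true → Exec M s s' T)
    (h' : p s.1 (s.2 k).head? = false → Exec N s s' T) : Exec (ite k p M N) s s' (T + 1) := by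
  cases hp : p s.1 (s.2 k).head?
  · obtain ⟨t, ht, h⟩ := h' hp
    refine ⟨t + 1, by lia, .head ?_⟩
    have := h.relabel (m' := (ite k p M N).code) (f := fun l => some (.inr l)) (e := none)
      fun _ => rfl
    simpa [ite, stepAux_testStmt, hp] using this
  · obtain ⟨t, ht, h⟩ := h hp
    refine ⟨t + 1, by lia, .head ?_⟩
    have := h.relabel (m' := (ite k p M N).code) (f := fun l => some (.inl l)) (e := none)
      fun _ => rfl
    simpa [ite, stepAux_testStmt, hp] using this

/-- Loop: as long as the test `p` succeeds, execute `M`. -/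
def loop (k : K) (p : σ → Option (Γ k) → Bool) (M : Fragment Γ σ) : Fragment Γ σ where
  Label := Option M.Label
  fin := haveI := M.fin; inferInstance
  entry := none
  code l := l.elim (testStmt k p (some (some M.entry)) none) fun l =>
    relabel some (some none) (M.code l)

theorem exec_loop_stop {k : K} {p : σ → Option (Γ k) → Bool} {M : Fragment Γ σ}
    {s : σ × ∀ k, List (Γ k)} (h : p s.1 (s.2 k).head? = false) : Exec (loop k p M) s s 1 := by
  refine ⟨1, le_rfl, .head ?_⟩
  simpa [loop, stepAux_testStmt, h] using Steps.refl _

theorem exec_loop_next {k : K} {p : σ → Option (Γ k) → Bool} {M : Fragment Γ σ}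
    {s s' s'' : σ × ∀ k, List (Γ k)} {T T' : ℕ} (h : p s.1 (s.2 k).head? = true)
    (hM : Exec M s s' T) (hL : Exec (loop k p M) s' s'' T') :
    Exec (loop k p M) s s'' (T + 1 + T') := by
  obtain ⟨t, ht, hM⟩ := hM
  obtain ⟨t', ht', hL⟩ := hL
  refine ⟨t + 1 + t', by lia, ?_⟩
  have := hM.relabel (m' := (loop k p M).code) (f := some) (e := some none) fun _ => rfl
  refine Steps.trans (.head ?_) hL
  simpa [loop, stepAux_testStmt, h] using this

theorem exec_loop {k : K} {p : σ → Option (Γ k) → Bool} {M : Fragment Γ σ} {T : ℕ}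
    (s : ℕ → σ × ∀ k, List (Γ k)) (N : ℕ) (h : ∀ i < N, p (s i).1 ((s i).2 k).head? = true)
    (hN : p (s N).1 ((s N).2 k).head? = false) (hM : ∀ i < N, Exec M (s i) (s (i + 1)) T) :
    Exec (loop k p M) (s 0) (s N) (N * (T + 1) + 1) := by
  induction N generalizing s with
  | zero => simpa using exec_loop_stop hN
  | succ N ih =>
    refine (exec_loop_next (h 0 (by lia)) (hM 0 (by lia)) (ih (fun i => s (i + 1))
      (fun i hi => h _ (by lia)) hN fun i hi => hM _ (by lia))).mono (by lia)

end Fragments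

/-! ### The concrete stacks and elementary instructions. -/

section Stacks

/-- The stacks of our machines that carry words over `Γ'`: the input, an auxiliary word, the query
under construction, the number of vertices and a temporary number in unary, and for each variable
its value and the counter of the loop that binds it, in unary. -/
inductive Reg (ι : Type)
  | inp
  | aux
  | qry
  | cnt
  | tmp
  | var (i : ι)
  | co (i : ι)
  deriving DecidableEq, Fintype

/-- All stacks: our own ones, the output, and those of an oracle machine. -/
inductive Stk (ι κ : Type)
  | own (r : Reg ι)
  | out
  | orc (k : κ)
  deriving DecidableEq, Fintype

variable {ι : Type} {O : FinTM2}

/-- The stack alphabets. -/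
def alphabet (ι : Type) (O : FinTM2) : Stk ι O.K → Type
  | .own _ => Γ'
  | .out => Bool
  | .orc k => O.Γ k

/-- The contents of all stacks. -/
def contents (s : Reg ι → List Γ') (b : List Bool) (S : ∀ k, List (O.Γ k)) :
    ∀ k, List (alphabet ι O k)
  | .own r => s r
  | .out => b
  | .orc k => S k

variable [DecidableEq ι]

theorem update_contents_own (s : Reg ι → List Γ') (b : List Bool) (S : ∀ k, List (O.Γ k))
    (r : Reg ι) (w : List Γ') :
    update (contents s b S) (.own r) w = contents (update s r w) b S := by
  funext k
  rcases k with r' | _ | k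
  · by_cases h : r' = r
    · subst h
      exact (update_self ..).trans (update_self (β := fun _ => List Γ') ..).symm
    · exact (update_of_ne (by simpa using h) ..).trans
        (update_of_ne (β := fun _ => List Γ') h ..).symm
  · exact update_of_ne (by simp) ..
  · exact update_of_ne (by simp) ..

theorem update_contents_out (s : Reg ι → List Γ') (b : List Bool) (S : ∀ k, List (O.Γ k))
    (w : List Bool) : update (contents s b S) .out w = contents s w S := by
  funext k
  rcases k with r' | _ | k
  · exact update_of_ne (by simp) ..
  · exact update_self ..
  · exact update_of_ne (by simp) ..

theorem update_contents_orc (s : Reg ι → List Γ') (b : List Bool) (S : ∀ k, List (O.Γ k))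
    (k : O.K) (w : List (O.Γ k)) :
    update (contents s b S) (.orc k) w = contents s b (update S k w) := by
  funext k'
  rcases k' with r' | _ | k'
  · exact update_of_ne (by simp) ..
  · exact update_of_ne (by simp) ..
  · by_cases h : k' = k
    · subst h
      exact (update_self ..).trans (update_self (β := fun k => List (O.Γ k)) ..).symm
    · exact (update_of_ne (by simpa using h) ..).trans
        (update_of_ne (β := fun k => List (O.Γ k)) h ..).symm

/-- The fragments with variables in `ι` that may use the machine `O`. Their local store consists of
a truth value and the local store of `O`. -/
abbrev Prog (ι : Type) [DecidableEq ι] (O : FinTM2) : Type 1 :=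
  Fragment (alphabet ι O) (Bool × O.σ)

/-- The state between two fragments. -/
def full (O : FinTM2) (s : Bool × (Reg ι → List Γ')) :
    (Bool × O.σ) × ∀ k, List (alphabet ι O k) :=
  ((s.1, O.initialState), contents s.2 [] fun _ => [])

/-- `Exec` for states in which the output and the stacks of the oracle machine are empty. -/
def Runs (M : Prog ι O) (s s' : Bool × (Reg ι → List Γ')) (T : ℕ) : Prop :=
  Exec M (full O s) (full O s') T

theorem Runs.mono {M : Prog ι O} {s s' : Bool × (Reg ι → List Γ')} {T T' : ℕ}
    (h : Runs M s s' T) (hT : T ≤ T') : Runs M s s' T' := Exec.mono h hT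

theorem Runs.seq {M N : Prog ι O} {s s' s'' : Bool × (Reg ι → List Γ')} {T T' : ℕ}
    (h : Runs M s s' T) (h' : Runs N s' s'' T') : Runs (M ;; N) s s'' (T + T') := Exec.seq h h'

/-- Do nothing. -/
def skip : Prog ι O := basic .halt

theorem runs_skip (s : Bool × (Reg ι → List Γ')) : Runs (skip : Prog ι O) s s 1 :=
  exec_basic rfl

/-- Push a symbol that may depend on the truth value. -/
def push (r : Reg ι) (f : Bool → Γ') : Prog ι O :=
  basic (.push (.own r) (fun v => f v.1.1) .halt)

theorem runs_push (r : Reg ι) (f : Bool → Γ') (s : Bool × (Reg ι → List Γ')) :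
    Runs (push r f : Prog ι O) s (s.1, update s.2 r (f s.1 :: s.2 r)) 1 :=
  exec_basic (congrArg (Cfg.mk none _) (update_contents_own ..))

/-- Remove the top of a stack. -/
def pop (r : Reg ι) : Prog ι O := basic (.pop (.own r) (fun v _ => v) .halt)

theorem runs_pop (r : Reg ι) (s : Bool × (Reg ι → List Γ')) :
    Runs (pop r : Prog ι O) s (s.1, update s.2 r (s.2 r).tail) 1 :=
  exec_basic (congrArg (Cfg.mk none _) (update_contents_own ..))

/-- Move the top of a stack to another one. -/
def move (r r' : Reg ι) : Prog ι O :=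
  basic (.pop (.own r) (fun v o => (v.1, o)) <| .push (.own r') (fun v => v.2.getD Γ'.blank) <|
    .load (fun v => (v.1, none)) .halt)

theorem runs_move (r r' : Reg ι) (s : Bool × (Reg ι → List Γ')) (a : Γ') (w : List Γ')
    (hs : s.2 r = a :: w) (hr : r ≠ r') :
    Runs (move r r' : Prog ι O) s (s.1, update (update s.2 r w) r' (a :: s.2 r')) 1 := by
  -- The stacks after the pop are only provably of the form `contents _ _ _`; a general `C` avoids
  -- rewriting inside dependent updates.
  have h : ∀ (C : ∀ k, List (alphabet ι O k)) (s₁ : Reg ι → List Γ'),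
      C = contents s₁ [] (fun _ => []) → s₁ r' = s.2 r' →
      update C (.own r') ((s.2 r).head?.getD Γ'.blank :: C (.own r')) =
        contents (update s₁ r' (a :: s.2 r')) [] fun _ => [] := by
    rintro C s₁ rfl h
    rw [hs, ← h]
    exact update_contents_own ..
  refine exec_basic (congrArg (Cfg.mk none _) (h _ (update s.2 r w) ?_ (update_of_ne hr.symm ..)))
  refine (update_contents_own ..).trans ?_
  change contents (update s.2 r (s.2 r).tail) _ _ = _
  rw [hs]
  rfl

/-- Set the truth value, depending on its old value and the top of a stack. -/
def setFlag (r : Reg ι) (f : Bool → Option Γ' → Bool) : Prog ι O :=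
  basic (.peek (.own r) (fun v o => ((f v.1.1 o, v.1.2), v.2)) .halt)

theorem runs_setFlag (r : Reg ι) (f : Bool → Option Γ' → Bool) (s : Bool × (Reg ι → List Γ')) :
    Runs (setFlag r f : Prog ι O) s (f s.1 (s.2 r).head?, s.2) 1 :=
  exec_basic rfl

/-- Conditional on the truth value and the top of a stack. -/
def cond (r : Reg ι) (p : Bool → Option Γ' → Bool) (M N : Prog ι O) : Prog ι O :=
  ite (Γ := alphabet ι O) (.own r) (fun v o => p v.1 o) M N

theorem runs_cond {r : Reg ι} {p : Bool → Option Γ' → Bool} {M N : Prog ι O}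
    {s s' : Bool × (Reg ι → List Γ')} {T : ℕ}
    (h : p s.1 (s.2 r).head? = true → Runs M s s' T)
    (h' : p s.1 (s.2 r).head? = false → Runs N s s' T) : Runs (cond r p M N) s s' (T + 1) :=
  exec_ite h h'

/-- Loop, conditional on the truth value and the top of a stack. -/
def whileDo (r : Reg ι) (p : Bool → Option Γ' → Bool) (M : Prog ι O) : Prog ι O :=
  loop (Γ := alphabet ι O) (.own r) (fun v o => p v.1 o) M

theorem runs_whileDo_stop {r : Reg ι} {p : Bool → Option Γ' → Bool} {M : Prog ι O}
    {s : Bool × (Reg ι → List Γ')} (h : p s.1 (s.2 r).head? = false) :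
    Runs (whileDo r p M) s s 1 := exec_loop_stop h

theorem runs_whileDo_next {r : Reg ι} {p : Bool → Option Γ' → Bool} {M : Prog ι O}
    {s s' s'' : Bool × (Reg ι → List Γ')} {T T' : ℕ} (h : p s.1 (s.2 r).head? = true)
    (hM : Runs M s s' T) (hL : Runs (whileDo r p M) s' s'' T') :
    Runs (whileDo r p M) s s'' (T + 1 + T') := exec_loop_next h hM hL

theorem runs_whileDo {r : Reg ι} {p : Bool → Option Γ' → Bool} {M : Prog ι O} {T : ℕ}
    (s : ℕ → Bool × (Reg ι → List Γ')) (N : ℕ)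
    (h : ∀ i < N, p (s i).1 ((s i).2 r).head? = true)
    (hN : p (s N).1 ((s N).2 r).head? = false) (hM : ∀ i < N, Runs M (s i) (s (i + 1)) T) :
    Runs (whileDo r p M) (s 0) (s N) (N * (T + 1) + 1) :=
  exec_loop (fun i => full O (s i)) N h hN hM

end Stacks

end Bondage

namespace Bondage

open Turing Turing.TM2 Computability Function

/-! ### Calling another machine as a subroutine. -/

section Oracle

theorem stk_initList (O : FinTM2) (w : List (O.Γ O.k₀)) :
    (initList O w).stk = update (fun _ => []) O.k₀ w := by
  funext k
  by_cases h : k = O.k₀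
  · subst h; simp [initList]
  · simp [initList, h]

theorem stk_haltList (O : FinTM2) (w : List (O.Γ O.k₁)) :
    (haltList O w).stk = update (fun _ => []) O.k₁ w := by
  funext k
  by_cases h : k = O.k₁
  · subst h; simp [haltList]
  · simp [haltList, h]

theorem steps_of_iterate {K : Type} [DecidableEq K] {Γ : K → Type} {Λ σ : Type}
    {m : Λ → Stmt Γ Λ σ} {t : ℕ} {c c' : Cfg Γ Λ σ}
    (h : (flip bind (step m))^[t] (some c) = some c') : Steps m t c c' := by
  induction t generalizing c with
  | zero => cases h; exact .refl _
  | succ t ih =>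
    rw [iterate_succ_apply] at h
    rcases c with ⟨_ | l, v, S⟩
    -- A halted configuration has no successor, so no further step can lead to `some c'`.
    · have : ∀ t, (flip bind (step m))^[t] none = none := fun t => iterate_fixed rfl t
      exact absurd (h.symm.trans (this t)) (by simp)
    · exact .head (ih h)

theorem iterate_of_steps {K : Type} [DecidableEq K] {Γ : K → Type} {Λ σ : Type}
    {m : Λ → Stmt Γ Λ σ} {t : ℕ} {c c' : Cfg Γ Λ σ}
    (h : Steps m t c c') : (flip bind (step m))^[t] (some c) = some c' := by
  induction h with
  | refl => rfl
  | head _ ih => rw [iterate_succ_apply]; exact ih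

variable {ι : Type} [DecidableEq ι] {O : FinTM2}

/-- A statement of the oracle machine, acting on its part of the stacks. -/
def embed (ι : Type) (O : FinTM2) {Λ : Type} : Stmt O.Γ Λ O.σ →
    Stmt (alphabet ι O) Λ ((Bool × O.σ) × Option Γ')
  | .push k g q => .push (.orc k) (fun v => g v.1.2) (embed ι O q)
  | .peek k g q => .peek (.orc k) (fun v o => ((v.1.1, g v.1.2 o), v.2)) (embed ι O q)
  | .pop k g q => .pop (.orc k) (fun v o => ((v.1.1, g v.1.2 o), v.2)) (embed ι O q)
  | .load g q => .load (fun v => ((v.1.1, g v.1.2), v.2)) (embed ι O q)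
  | .branch b q₁ q₂ => .branch (fun v => b v.1.2) (embed ι O q₁) (embed ι O q₂)
  | .goto g => .goto fun v => g v.1.2
  | .halt => .halt

theorem stepAux_embed {Λ : Type} (q : Stmt O.Γ Λ O.σ) (v : O.σ) (S : ∀ k, List (O.Γ k))
    (fl : Bool) (o : Option Γ') (s : Reg ι → List Γ') (b : List Bool) :
    stepAux (embed ι O q) ((fl, v), o) (contents s b S) = ⟨(stepAux q v S).l,
      ((fl, (stepAux q v S).var), o), contents s b (stepAux q v S).stk⟩ := by
  induction q generalizing v S with
  | push k g q ih =>
    refine Eq.trans ?_ (ih _ _)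
    exact congrArg (stepAux (embed ι O q) ((fl, v), o)) (update_contents_orc ..)
  | peek k g q ih => exact ih _ _
  | pop k g q ih =>
    refine Eq.trans ?_ (ih _ _)
    exact congrArg (stepAux (embed ι O q) _) (update_contents_orc ..)
  | load g q ih => exact ih _ _
  | branch b q₁ q₂ ih₁ ih₂ => cases h : b v <;> simp [embed, ih₁, ih₂, h]
  | goto g => rfl
  | halt => rfl

/-- Run the oracle machine. -/
def oracle : Prog ι O := ⟨O.Λ, O.ΛFin, O.main, fun l => embed ι O (O.m l)⟩

theorem Steps.embed {m : O.Λ → Stmt O.Γ O.Λ O.σ} {t : ℕ} {c c' : Cfg O.Γ O.Λ O.σ}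
    (h : Steps m t c c') (fl : Bool) (o : Option Γ') (s : Reg ι → List Γ') (b : List Bool) :
    Steps (fun l => embed ι O (m l)) t ⟨c.l, ((fl, c.var), o), contents s b c.stk⟩
      ⟨c'.l, ((fl, c'.var), o), contents s b c'.stk⟩ := by
  induction h with
  | refl => exact .refl _
  | head _ ih => exact .head (by rw [stepAux_embed]; exact ih)

/-- A final configuration in the sense of `haltList` has the initial local store and no stack
content besides the output. So once the answer is removed the machine is ready for another call. -/
theorem exec_oracle {w : List (O.Γ O.k₀)} {w' : List (O.Γ O.k₁)} {T : ℕ}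
    (h : TM2OutputsInTime O w (some w') T) (fl : Bool) (s : Reg ι → List Γ') :
    Exec (oracle : Prog ι O) ((fl, O.initialState), contents s [] (update (fun _ => []) O.k₀ w))
      ((fl, O.initialState), contents s [] (update (fun _ => []) O.k₁ w')) T := by
  refine ⟨h.steps, h.steps_le_m, ?_⟩
  have := (steps_of_iterate h.evals_in_steps).embed fl none s []
  rw [stk_initList, stk_haltList] at this
  exact this

/-- Move the top of the query to the input of the oracle machine. -/
def feed (e : O.Γ O.k₀ ≃ Γ') : Prog ι O :=
  basic (.pop (.own .qry) (fun v o => (v.1, o)) <|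
    .push (.orc O.k₀) (fun v => e.symm (v.2.getD Γ'.blank)) <| .load (fun v => (v.1, none)) .halt)

theorem exec_feed (e : O.Γ O.k₀ ≃ Γ') (v : Bool × O.σ) (s : Reg ι → List Γ') (a : Γ') (q : List Γ')
    (w : List (O.Γ O.k₀)) (hs : s .qry = a :: q) :
    Exec (feed e : Prog ι O) (v, contents s [] (update (fun _ => []) O.k₀ w))
      (v, contents (update s .qry q) [] (update (fun _ => []) O.k₀ (e.symm a :: w))) 1 := by
  have h : ∀ (C : ∀ k, List (alphabet ι O k)) (s₁ : Reg ι → List Γ'),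
      C = contents s₁ [] (update (fun _ => []) O.k₀ w) →
      update C (.orc O.k₀) (e.symm ((s .qry).head?.getD Γ'.blank) :: C (.orc O.k₀)) =
        contents s₁ [] (update (fun _ => []) O.k₀ (e.symm a :: w)) := by
    rintro C s₁ rfl
    refine (update_contents_orc ..).trans ?_
    rw [hs]
    change contents s₁ [] (update (update (fun _ => []) O.k₀ w) O.k₀
      (e.symm a :: update (fun k => ([] : List (O.Γ k))) O.k₀ w O.k₀)) = _
    simp
  refine exec_basic (congrArg (Cfg.mk none _) (h _ (update s .qry q) ?_))
  refine (update_contents_own ..).trans ?_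
  change contents (update s .qry (s .qry).tail) _ _ = _
  rw [hs]
  rfl

/-- Remove the output of the oracle machine and store it as truth value. -/
def answer (e : O.Γ O.k₁ ≃ Bool) : Prog ι O :=
  basic (.pop (.orc O.k₁) (fun v o => ((o.elim false e, v.1.2), v.2)) .halt)

theorem exec_answer (e : O.Γ O.k₁ ≃ Bool) (v : Bool × O.σ) (s : Reg ι → List Γ') (b : Bool) :
    Exec (answer e : Prog ι O) (v, contents s [] (update (fun _ => []) O.k₁ [e.symm b]))
      ((b, v.2), contents s [] fun _ => []) 1 := by
  refine exec_basic ?_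
  change Cfg.mk none ((Option.elim (List.head? (update (fun _ => []) O.k₁ [e.symm b] O.k₁)) false e,
    v.2), none) (update (contents s [] _) (.orc O.k₁) _) = _
  refine congrArg₂ (fun x y => Cfg.mk none ((x, v.2), none) y) (by simp) ?_
  refine (update_contents_orc ..).trans ?_
  change contents s [] (update (update (fun _ => []) O.k₁ [e.symm b]) O.k₁
    (List.tail (update (fun k => ([] : List (O.Γ k))) O.k₁ [e.symm b] O.k₁))) = _
  simp

/-- Submit the query to the oracle machine. -/
def ask (e : O.Γ O.k₀ ≃ Γ') (e' : O.Γ O.k₁ ≃ Bool) : Prog ι O :=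
  loop (Γ := alphabet ι O) (.own .qry) (fun _ o => o.isSome) (feed e) ;; oracle ;; answer e'

theorem runs_ask (e : O.Γ O.k₀ ≃ Γ') (e' : O.Γ O.k₁ ≃ Bool) {w : List Γ'} {b : Bool} {T : ℕ}
    (h : TM2OutputsInTime O (w.map e.symm) (some ((encodeBool b).map e'.symm)) T) (fl : Bool)
    (s : Reg ι → List Γ') (hs : s .qry = w.reverse) :
    Runs (ask e e') (fl, s) (b, update s .qry []) (w.length * 2 + 1 + (T + 1)) := by
  -- Here `w'` is the part already fed. The query stack holds `w` reversed, so popping it onto the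
  -- input stack leaves the first letter of `w` on top.
  have key : ∀ (q w' : List Γ') (s : Reg ι → List Γ'), s .qry = q →
      Exec (loop (Γ := alphabet ι O) (.own .qry) (fun _ o => o.isSome) (feed e))
        ((fl, O.initialState), contents s [] (update (fun _ => []) O.k₀ (w'.map e.symm)))
        ((fl, O.initialState), contents (update s .qry []) []
          (update (fun _ => []) O.k₀ ((q.reverse ++ w').map e.symm))) (q.length * 2 + 1) := by
    intro q
    induction q with
    | nil =>
      intro w' s hs
      rw [← hs, update_eq_self, hs]
      refine exec_loop_stop (Γ := alphabet ι O) (k := .own .qry) ?_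
      change Option.isSome (s .qry).head? = false
      rw [hs]
      rfl
    | cons a q ih =>
      intro w' s hs
      have h₂ := ih (a :: w') (update s .qry q) (by simp)
      rw [update_idem] at h₂
      refine (exec_loop_next (Γ := alphabet ι O) (k := .own .qry) ?_ (exec_feed e _ s a q _ hs) (by simpa using h₂)).mono (by simp; lia)
      change Option.isSome (s .qry).head? = true
      rw [hs]
      rfl
  have h₁ := key _ [] s hs
  rw [List.reverse_reverse, List.append_nil, List.length_reverse] at h₁
  have h₀ : update (fun k : O.K => ([] : List (O.Γ k))) O.k₀ (List.map e.symm []) =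
      fun _ => [] := by
    simp
  rw [h₀] at h₁
  exact h₁.seq ((exec_oracle h _ _).seq (exec_answer ..))

end Oracle

/-! ### From fragments to Turing machines. -/

section Output

variable {ι : Type} [DecidableEq ι] {O : FinTM2}

/-- Write the truth value to the output and reset it. -/
def writeOut : Prog ι O :=
  basic (.push .out (fun v => v.1.1) <| .load (fun v => ((false, v.1.2), v.2)) .halt)

theorem exec_writeOut (b : Bool) (s : Reg ι → List Γ') :
    Exec (writeOut : Prog ι O) (full O (b, s))
      ((false, O.initialState), contents s [b] fun _ => []) 1 :=
  exec_basic (congrArg (Cfg.mk none _) (update_contents_out ..))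

/-- The machine that executes a fragment. -/
def machine [Fintype ι] (M : Prog ι O) : FinTM2 where
  K := Stk ι O.K
  kFin := haveI := O.kFin; inferInstance
  k₀ := .own .inp
  k₁ := .out
  Γ := alphabet ι O
  Λ := M.Label
  main := M.entry
  ΛFin := M.fin
  σ := (Bool × O.σ) × Option Γ'
  initialState := ((false, O.initialState), none)
  σFin := haveI := O.σFin; inferInstance
  Γk₀Fin := inferInstanceAs (Fintype Γ')
  m := M.code

theorem initList_machine [Fintype ι] (M : Prog ι O) (w : List Γ') :
    initList (machine M) w = ⟨some M.entry, ((false, O.initialState), none),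
      contents (update (fun _ => []) .inp w) [] fun _ => []⟩ := by
  refine congrArg (Cfg.mk _ _) ((stk_initList (machine M) w).trans ?_)
  refine Eq.trans (congrArg (fun C => update C _ _) ?_)
    (update_contents_own (O := O) (fun _ => []) [] (fun _ => []) .inp w)
  funext k
  rcases k with _ | _ | _ <;> rfl

theorem haltList_machine [Fintype ι] (M : Prog ι O) (w : List Bool) :
    haltList (machine M) w = ⟨none, ((false, O.initialState), none),
      contents (fun _ => []) w fun _ => []⟩ := by
  refine congrArg (Cfg.mk _ _) ((stk_haltList (machine M) w).trans ?_)
  refine Eq.trans (congrArg (fun C => update C _ _) ?_)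
    (update_contents_out (O := O) (fun _ => []) [] (fun _ => []) w)
  funext k
  rcases k with _ | _ | _ <;> rfl

/-- The fragment has to empty all its stacks, because a final configuration allows nothing but the
output; writing the answer costs the one extra step and resets the truth value. -/
theorem solvable_of_runs [Fintype ι] (M : Prog ι O) {α : Type} {encode : α → List Γ'} {I : Set α}
    {P : α → Prop} (p : Polynomial ℕ)
    (h : ∀ a ∈ I, ∀ b : Bool, (b = true ↔ P a) → Runs M
      (false, update (fun _ => []) .inp (encode a)) (b, fun _ => []) (p.eval (encode a).length)) :
    SolvableInPolyTimeOn encode I P := by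
  classical
  refine ⟨⟨⟨machine (M ;; writeOut), Equiv.refl Γ', Equiv.refl Bool⟩, p + 1, fun a => ?_⟩⟩
  have h₁ := Exec.seq (h a.1 a.2 (decide (P a)) (by simp)) (exec_writeOut _ _)
  refine Classical.choice ?_
  obtain ⟨t, ht, h₂⟩ := h₁
  refine ⟨⟨⟨t, (iterate_of_steps (m := (M ;; writeOut).code) ?_)⟩, by simpa using ht⟩⟩
  have e₁ := (congrArg (initList (machine (M ;; writeOut))) (List.map_id (encode a.1))).trans
    (initList_machine ..)
  have e₂ := (congrArg (haltList (machine (M ;; writeOut))) (List.map_id [decide (P a.1)])).trans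
    (haltList_machine ..)
  exact e₁ ▸ e₂ ▸ h₂

end Output

end Bondage

namespace Bondage

open Turing Turing.TM2 Computability Function

/-! ### Unary counters. -/

section Counters

variable {ι : Type} [DecidableEq ι] {O : FinTM2}

theorem Runs.to {M : Prog ι O} {s s' s'' : Bool × (Reg ι → List Γ')} {T T' : ℕ}
    (h : Runs M s s' T) (hs : s' = s'') (hT : T ≤ T') : Runs M s s'' T' :=
  hs ▸ h.mono hT

theorem Runs.of_eq {M : Prog ι O} {s s' s'' : Bool × (Reg ι → List Γ')} {T : ℕ}
    (h : Runs M s s' T) (hs : s = s'') : Runs M s'' s' T := hs ▸ h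

/-- The number `n` in unary. -/
def blanks (n : ℕ) : List Γ' := List.replicate n Γ'.blank

@[simp] theorem blanks_zero : blanks 0 = [] := rfl

theorem blanks_succ (n : ℕ) : blanks (n + 1) = Γ'.blank :: blanks n := rfl

@[simp] theorem length_blanks (n : ℕ) : (blanks n).length = n := List.length_replicate

@[simp] theorem reverse_blanks (n : ℕ) : (blanks n).reverse = blanks n := List.reverse_replicate

theorem blanks_append_blanks (m n : ℕ) : blanks m ++ blanks n = blanks (m + n) :=
  List.replicate_append_replicate

theorem blanks_sub {i n : ℕ} (h : i < n) : blanks (n - i) = Γ'.blank :: blanks (n - (i + 1)) := by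
  rw [← blanks_succ]; congr 1; lia

@[simp] theorem tail_blanks (n : ℕ) : (blanks n).tail = blanks (n - 1) := by
  cases n <;> rfl

@[simp] theorem isSome_head?_blanks (n : ℕ) : (blanks n).head?.isSome = decide (0 < n) := by
  cases n <;> simp [blanks, List.replicate_succ]

/-- The test whether a stack is nonempty. -/
def nonempty (_ : Bool) (o : Option Γ') : Bool := o.isSome

/-- Pour the stack `r` onto the stack `r'`. -/
def moveAll (r r' : Reg ι) : Prog ι O := whileDo r nonempty (move r r')

theorem runs_moveAll {r r' : Reg ι} (hr : r ≠ r') (b : Bool) (s : Reg ι → List Γ') :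
    Runs (moveAll r r' : Prog ι O) (b, s)
      (b, update (update s r []) r' ((s r).reverse ++ s r')) (2 * (s r).length + 1) := by
  induction hw : s r generalizing s with
  | nil =>
    refine (runs_whileDo_stop (by simp [hw, nonempty])).to ?_ (by simp)
    have h : update s r [] = s := by rw [← hw, update_eq_self]
    rw [List.reverse_nil, List.nil_append, h, update_eq_self]
  | cons a w ih =>
    have h := ih (update (update s r w) r' (a :: s r')) (by simp [hr])
    refine (runs_whileDo_next (by simp [hw, nonempty]) (runs_move r r' (b, s) a w hw hr) h).to ?_
      (by simp; lia)
    simp only [Prod.mk.injEq, true_and]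
    funext k
    simp only [update_apply]
    split_ifs <;> simp_all

/-- Empty a stack. -/
def clear (r : Reg ι) : Prog ι O := whileDo r nonempty (pop r)

theorem runs_clear (r : Reg ι) (b : Bool) (s : Reg ι → List Γ') :
    Runs (clear r : Prog ι O) (b, s) (b, update s r []) (2 * (s r).length + 1) := by
  induction hw : s r generalizing s with
  | nil =>
    refine (runs_whileDo_stop (by simp [hw, nonempty])).to ?_ (by simp)
    simp [← hw]
  | cons a w ih =>
    have h := ih (update s r w) (by simp)
    refine (runs_whileDo_next (by simp [hw, nonempty])
      ((runs_pop r (b, s)).to (by simp only [hw]; rfl) le_rfl) h).to (by simp) (by simp; lia)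

/-- Add the unary number on `r` to the one on `r'`, using the empty stack `t`. -/
def addTo (r t r' : Reg ι) : Prog ι O :=
  whileDo r nonempty (move r t ;; push r' fun _ => Γ'.blank) ;; moveAll t r

theorem runs_addTo {r t r' : Reg ι} (h₁ : r ≠ t) (h₂ : r ≠ r') (h₃ : t ≠ r') (b : Bool)
    (s : Reg ι → List Γ') (n : ℕ) (hn : s r = blanks n) (ht : s t = []) :
    Runs (addTo r t r' : Prog ι O) (b, s) (b, update s r' (blanks n ++ s r')) (5 * n + 2) := by
  have hloop := runs_whileDo (O := O) (r := r) (p := nonempty)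
    (M := move r t ;; push r' fun _ => Γ'.blank) (T := 2)
    -- After `i` rounds `i` symbols have gone to `t`, each with a copy on `r'`; pouring `t` back
    -- restores `r`.
    (fun i => (b, update (update (update s r (blanks (n - i))) t (blanks i)) r'
      (blanks i ++ s r'))) n
    (by intro i hi; simp [nonempty, h₁, h₂, hi]) (by simp [nonempty, h₁, h₂]) (by
      intro i hi
      refine (Runs.seq (runs_move _ _ _ Γ'.blank (blanks (n - (i + 1)))
        (by simp [h₁, h₂, blanks_sub hi]) h₁) (runs_push ..)).to ?_ le_rfl
      simp only [Prod.mk.injEq, true_and]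
      funext k
      simp only [update_apply]
      split_ifs <;> simp_all [blanks_succ])
  refine Runs.to (Runs.seq (hloop.of_eq (s'' := (b, s)) ?_) (runs_moveAll h₁.symm ..)) ?_
    (by simp [update_of_ne h₃]; lia)
  · simp [← hn, ← ht]
  · simp only [Prod.mk.injEq, true_and]
    funext k
    simp only [update_apply]
    split_ifs <;> simp_all

end Counters

end Bondage

namespace Bondage

open Turing Turing.TM2 Computability Function

theorem eval_mono (p : Polynomial ℕ) {m n : ℕ} (h : m ≤ n) : p.eval m ≤ p.eval n := by
  simp only [Polynomial.eval_eq_sum, Polynomial.sum]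
  gcongr

/-! ### A calculus of polynomial-time formulas and words. -/

section Formulas

variable {ι : Type} [DecidableEq ι] {O : FinTM2} {C : Set FinGraph} {Q : Set (List Γ')}
  {X : Finset ι} {φ ψ : FinGraph → (ι → ℕ) → Prop}

/-- The contents of the stacks when the variables in `X` are bound to the values given by `env` and
the word `q` is on the query stack. -/
noncomputable def store (G : FinGraph) (X : Finset ι) (env : ι → ℕ) (q : List Γ') :
    Reg ι → List Γ'
  | .inp => encodeGraph G
  | .aux => []
  | .qry => q
  | .cnt => blanks G.1
  | .tmp => []
  | .var i => blanks (env i)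
  | .co i => if i ∈ X then blanks (G.1 - env i) else []

/-- The variables in `X` are bound to vertices, the other ones are zero. -/
def Valid (n : ℕ) (X : Finset ι) (env : ι → ℕ) : Prop :=
  (∀ i ∈ X, env i < n) ∧ ∀ i ∉ X, env i = 0

/-- For graphs in `C`, the property `φ` of the values of the variables in `X` can be evaluated in
polynomial time by a fragment that may use the machine `O`, provided that the word on the query
stack is in `Q`. -/
def Evaluable (O : FinTM2) (C : Set FinGraph) (Q : Set (List Γ')) (X : Finset ι)
    (φ : FinGraph → (ι → ℕ) → Prop) : Prop :=
  ∃ (M : Prog ι O) (p : Polynomial ℕ), ∀ G ∈ C, ∀ env, Valid G.1 X env → ∀ q ∈ Q, ∀ b b' : Bool,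
    (b' = true ↔ φ G env) → Runs M (b, store G X env q) (b', store G X env q) (p.eval G.1)

/-- For graphs in `C`, the word `w`, which depends on the values of the variables in `X`, can be
written on the query stack in polynomial time. -/
def Emittable (O : FinTM2) (C : Set FinGraph) (X : Finset ι)
    (w : FinGraph → (ι → ℕ) → List Γ') : Prop :=
  ∃ (M : Prog ι O) (p : Polynomial ℕ), ∀ G ∈ C, ∀ env, Valid G.1 X env →
    (w G env).length ≤ p.eval G.1 ∧ ∀ q, Runs M (false, store G X env q)
      (false, store G X env ((w G env).reverse ++ q)) (p.eval G.1)

theorem Evaluable.congr (h : Evaluable O C Q X φ)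
    (hφ : ∀ G ∈ C, ∀ env, Valid G.1 X env → (φ G env ↔ ψ G env)) : Evaluable O C Q X ψ := by
  obtain ⟨M, p, h⟩ := h
  exact ⟨M, p, fun G hG env hv q hq b b' hb =>
    h G hG env hv q hq b b' (hb.trans (hφ G hG env hv).symm)⟩

theorem Emittable.congr {w w' : FinGraph → (ι → ℕ) → List Γ'} (h : Emittable O C X w)
    (hw : ∀ G ∈ C, ∀ env, Valid G.1 X env → w G env = w' G env) : Emittable O C X w' := by
  obtain ⟨M, p, h⟩ := h
  exact ⟨M, p, fun G hG env hv => hw G hG env hv ▸ h G hG env hv⟩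

theorem Evaluable.const (a : Prop) : Evaluable O C Q X fun _ _ => a := by
  classical
  refine ⟨setFlag .tmp fun _ _ => decide a, 1, fun G hG env hv q hq b b' hb => ?_⟩
  obtain rfl : b' = decide a := by cases b' <;> simp_all
  simpa using runs_setFlag Reg.tmp (fun _ _ => decide a) (b, store G X env q)

theorem Evaluable.not (h : Evaluable O C Q X φ) : Evaluable O C Q X fun G env => ¬ φ G env := by
  obtain ⟨M, p, h⟩ := h
  refine ⟨M ;; setFlag .tmp fun b _ => !b, p + 1, fun G hG env hv q hq b b' hb => ?_⟩
  have h := (h G hG env hv q hq b (!b') (by rw [← not_iff_not]; simpa using hb)).seq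
    (runs_setFlag .tmp (fun b _ => !b) _)
  simpa using h

theorem Evaluable.and (hφ : Evaluable O C Q X φ) (hψ : Evaluable O C Q X ψ) :
    Evaluable O C Q X fun G env => φ G env ∧ ψ G env := by
  classical
  obtain ⟨M, p, hM⟩ := hφ
  obtain ⟨N, p', hN⟩ := hψ
  refine ⟨M ;; cond .tmp (fun b _ => b) N skip, p + (p' + 1 + 1),
    fun G hG env hv q hq b b' hb => ?_⟩
  have h₁ := hM G hG env hv q hq b (decide (φ G env)) (by simp)
  refine (h₁.seq (runs_cond (T := p'.eval G.1 + 1) (s' := (b', store G X env q))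
    (fun h => ?_) fun h => ?_)).mono (by simp)
  · exact (hN G hG env hv q hq _ _ (by simp_all)).mono (by simp)
  · have : b' = decide (φ G env) := by simp_all
    exact this ▸ (runs_skip _).mono (by simp)

theorem Evaluable.or (hφ : Evaluable O C Q X φ) (hψ : Evaluable O C Q X ψ) :
    Evaluable O C Q X fun G env => φ G env ∨ ψ G env :=
  (hφ.not.and hψ.not).not.congr fun _ _ _ _ => by tauto

theorem Evaluable.exists_mem {α : Type*} (l : List α) {φ : α → FinGraph → (ι → ℕ) → Prop}
    (h : ∀ a ∈ l, Evaluable O C Q X (φ a)) :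
    Evaluable O C Q X fun G env => ∃ a ∈ l, φ a G env := by
  induction l with
  | nil => exact (Evaluable.const False).congr (by simp)
  | cons a l ih =>
    exact ((h a (by simp)).or (ih fun a ha => h a (by simp [ha]))).congr (by simp)

theorem Evaluable.forall_mem {α : Type*} (l : List α) {φ : α → FinGraph → (ι → ℕ) → Prop}
    (h : ∀ a ∈ l, Evaluable O C Q X (φ a)) :
    Evaluable O C Q X fun G env => ∀ a ∈ l, φ a G env :=
  (Evaluable.exists_mem l fun a ha => (h a ha).not).not.congr (by simp)

section Loops

variable {x : ι}

theorem Valid.update {n : ℕ} {env : ι → ℕ} (h : Valid n X env) (hx : x ∉ X) {v : ℕ} (hv : v < n) :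
    Valid n (insert x X) (update env x v) := by
  constructor
  · intro i hi
    by_cases hix : i = x
    · subst hix; simpa using hv
    · simpa [hix] using h.1 i (by simpa [hix] using hi)
  · intro i hi
    obtain ⟨hix, hi⟩ : i ≠ x ∧ i ∉ X := by simpa using hi
    simpa [hix] using h.2 i hi

/-- Start a loop that binds the variable `x` to the vertices. -/
def openLoop (x : ι) : Prog ι O := addTo .cnt .tmp (.co x)

theorem runs_openLoop {G : FinGraph} {env : ι → ℕ} (h : Valid G.1 X env) (hx : x ∉ X)
    (q : List Γ') (b : Bool) : Runs (openLoop x : Prog ι O) (b, store G X env q)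
      (b, store G (insert x X) (update env x 0) q) (5 * G.1 + 2) := by
  refine (runs_addTo (by simp) (by simp) (by simp) b (store G X env q) G.1 rfl rfl).to ?_ le_rfl
  simp only [Prod.mk.injEq, true_and]
  have h0 := h.2 x hx
  funext k
  rcases k with _ | _ | _ | _ | _ | i | i
  iterate 5 simp [store]
  · by_cases hi : i = x
    · subst hi; simp [store, h0]
    · simp [store, hi]
  · by_cases hi : i = x
    · subst hi; simp [store, hx]
    · simp [store, hi]

/-- Advance the variable `x` of a loop. -/
def nextLoop (x : ι) : Prog ι O := move (.co x) (.var x)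

theorem runs_nextLoop (G : FinGraph) (env : ι → ℕ) {v : ℕ} (hv : v < G.1)
    (q : List Γ') (b : Bool) :
    Runs (nextLoop x : Prog ι O) (b, store G (insert x X) (update env x v) q)
      (b, store G (insert x X) (update env x (v + 1)) q) 1 := by
  refine (runs_move (.co x) (.var x) _ Γ'.blank (blanks (G.1 - (v + 1)))
    (by simp [store, blanks_sub hv]) (by simp)).to ?_ le_rfl
  simp only [Prod.mk.injEq, true_and]
  funext k
  rcases k with _ | _ | _ | _ | _ | i | i
  iterate 5 simp [store]
  · by_cases hi : i = x
    · subst hi; simp [store, blanks_succ]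
    · simp [store, hi]
  · by_cases hi : i = x
    · subst hi; simp [store]
    · simp [store, hi]

/-- Finish a loop that binds the variable `x`. -/
def closeLoop (x : ι) : Prog ι O := clear (.co x) ;; clear (.var x)

theorem runs_closeLoop {G : FinGraph} {env : ι → ℕ} (h : Valid G.1 X env) (hx : x ∉ X) {v : ℕ}
    (hv : v ≤ G.1) (q : List Γ') (b : Bool) :
    Runs (closeLoop x : Prog ι O) (b, store G (insert x X) (update env x v) q)
      (b, store G X env q) (2 * G.1 + 2) := by
  refine ((runs_clear ..).seq (runs_clear ..)).to ?_ (by simp [store]; lia)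
  simp only [Prod.mk.injEq, true_and]
  have h0 := h.2 x hx
  funext k
  rcases k with _ | _ | _ | _ | _ | i | i
  iterate 5 simp [store]
  · by_cases hi : i = x
    · subst hi; simp [store, h0]
    · simp [store, hi]
  · by_cases hi : i = x
    · subst hi; simp [store, hx]
    · simp [store, hi]

/-- Linear search over the vertices, stopped at the first witness. The quantifier multiplies the
time by about `n`, so a fixed number of quantifiers stays polynomial. -/
theorem Evaluable.ex (h : Evaluable O C Q (insert x X) φ) (hx : x ∉ X) :
    Evaluable O C Q X fun G env => ∃ v < G.1, φ G (update env x v) := by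
  classical
  obtain ⟨M, p, h⟩ := h
  refine ⟨openLoop x ;; setFlag .tmp (fun _ _ => false) ;; whileDo (.co x)
    (fun b o => !b && o.isSome) (M ;; cond .tmp (fun b _ => b) skip (nextLoop x)) ;; closeLoop x,
    .X * (p + 3) + 7 * .X + 6, fun G hG env hv q hq b b' hb => ?_⟩
  -- The search is at `v` with `m` candidates left. The final position `u` is the witness found, or
  -- `n`; closing the loop works from either.
  have key : ∀ m v (b' : Bool), v + m = G.1 →
      (b' = true ↔ ∃ u < G.1, v ≤ u ∧ φ G (update env x u)) → ∃ u ≤ G.1,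
      Runs (whileDo (.co x) (fun b o => !b && o.isSome)
        (M ;; cond .tmp (fun b _ => b) skip (nextLoop x)))
        (false, store G (insert x X) (update env x v) q)
        (b', store G (insert x X) (update env x u) q) (m * (p.eval G.1 + 3) + 1) := by
    intro m
    induction m with
    | zero =>
      intro v b' hm hb'
      obtain rfl : b' = false := by
        rw [← Bool.not_eq_true, hb']
        rintro ⟨u, hu, hu', -⟩
        lia
      refine ⟨v, by lia, (runs_whileDo_stop ?_).mono (by simp)⟩
      simp [store, ← hm]
    | succ m ih =>
      intro v b' hm hb'
      have hvn : v < G.1 := by lia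
      have hM := h G hG _ (hv.update hx hvn) q hq false (decide (φ G (update env x v))) (by simp)
      have htest : (fun (b : Bool) (o : Option Γ') => !b && o.isSome) false
          (store G (insert x X) (update env x v) q (.co x)).head? = true := by
        simp [store, hvn]
      by_cases hφ : φ G (update env x v)
      · obtain rfl : b' = true := hb'.2 ⟨v, hvn, le_rfl, hφ⟩
        refine ⟨v, hvn.le, ?_⟩
        rw [decide_eq_true hφ] at hM
        refine (runs_whileDo_next htest (hM.seq (runs_cond (T := 1) (fun _ => runs_skip _)
          (by simp))) (runs_whileDo_stop (by simp))).mono ?_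
        rw [Nat.succ_mul]; lia
      · obtain ⟨u, hu, hrun⟩ := ih (v + 1) b' (by lia) (by
          rw [hb']
          refine exists_congr fun u => and_congr_right fun _ => ⟨fun ⟨h₁, h₂⟩ => ⟨?_, h₂⟩,
            fun ⟨h₁, h₂⟩ => ⟨by lia, h₂⟩⟩
          rcases h₁.eq_or_lt with rfl | h₁
          · exact absurd h₂ hφ
          · exact h₁)
        refine ⟨u, hu, ?_⟩
        rw [decide_eq_false hφ] at hM
        refine (runs_whileDo_next htest (hM.seq (runs_cond (T := 1) (by simp)
          (fun _ => runs_nextLoop G env hvn q false))) hrun).mono ?_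
        rw [Nat.succ_mul]; lia
  obtain ⟨u, hu, hrun⟩ := key G.1 0 b' (by simp) (by simpa using hb)
  refine ((runs_openLoop hv hx q b).seq ((runs_setFlag ..).seq
    (hrun.seq (runs_closeLoop hv hx hu q b')))).mono ?_
  simp; lia

theorem Emittable.flatMap {w : FinGraph → (ι → ℕ) → List Γ'} (h : Emittable O C (insert x X) w)
    (hx : x ∉ X) : Emittable O C X fun G env =>
      (List.range G.1).flatMap fun v => w G (update env x v) := by
  obtain ⟨M, p, h⟩ := h
  refine ⟨openLoop x ;; whileDo (.co x) nonempty (M ;; nextLoop x) ;; closeLoop x,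
    .X * (p + 2) + 7 * .X + 5, fun G hG env hv => ⟨?_, fun q => ?_⟩⟩
  · rw [List.length_flatMap]
    have := List.sum_le_card_nsmul
      ((List.range G.1).map fun v => (w G (update env x v)).length) (p.eval G.1) (by
        simp only [List.mem_map, List.mem_range]
        rintro _ ⟨v, hvn, rfl⟩
        exact (h G hG _ (hv.update hx hvn)).1)
    simp at this
    simp
    lia
  · have hloop := runs_whileDo (O := O) (r := .co x) (p := nonempty) (M := M ;; nextLoop x)
      (T := p.eval G.1 + 1)
      (fun v => (false, store G (insert x X) (update env x v)
        (((List.range v).flatMap fun v => w G (update env x v)).reverse ++ q))) G.1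
      (by intro v hvn; simp [nonempty, store, hvn]) (by simp [nonempty, store]) (by
        intro v hvn
        refine (((h G hG _ (hv.update hx hvn)).2 _).seq (runs_nextLoop G env hvn _ _)).to ?_ le_rfl
        simp [List.range_succ])
    refine ((runs_openLoop hv hx q false).seq
      (hloop.seq (runs_closeLoop hv hx le_rfl _ _))).mono ?_
    simp; lia

end Loops

theorem Emittable.nil : Emittable O C X fun _ _ => [] :=
  ⟨skip, 1, fun _ _ _ _ => ⟨by simp, fun _ => by simpa using runs_skip _⟩⟩

theorem Emittable.singleton (a : Γ') : Emittable O C X fun _ _ => [a] := by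
  refine ⟨push .qry fun _ => a, 1, fun G hG env hv => ⟨by simp, fun q => ?_⟩⟩
  refine (runs_push ..).to ?_ (by simp)
  simp only [Prod.mk.injEq, true_and]
  funext k
  cases k <;> simp [store]

theorem Emittable.append {w w' : FinGraph → (ι → ℕ) → List Γ'} (h : Emittable O C X w)
    (h' : Emittable O C X w') : Emittable O C X fun G env => w G env ++ w' G env := by
  obtain ⟨M, p, h⟩ := h
  obtain ⟨N, p', h'⟩ := h'
  refine ⟨M ;; N, p + p', fun G hG env hv => ⟨?_, fun q => ?_⟩⟩
  · simpa using add_le_add (h G hG env hv).1 (h' G hG env hv).1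
  · exact (((h G hG env hv).2 q).seq ((h' G hG env hv).2 _)).to (by simp) (by simp)

theorem Emittable.flatMap_list {α : Type*} (l : List α) {w : α → FinGraph → (ι → ℕ) → List Γ'}
    (h : ∀ a ∈ l, Emittable O C X (w a)) :
    Emittable O C X fun G env => l.flatMap fun a => w a G env := by
  induction l with
  | nil => exact Emittable.nil
  | cons a l ih =>
    exact ((h a (by simp)).append (ih fun a ha => h a (by simp [ha]))).congr (by simp)

-- All query words must be allowed here, since the formula is evaluated while a partly written query
-- lies on the stack. The truth value is reset because emitting fragments start and end with
-- `false`.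
open scoped Classical in
theorem Evaluable.bit (h : Evaluable O C Set.univ X φ) :
    Emittable O C X fun G env => [Γ'.bit (decide (φ G env))] := by
  obtain ⟨M, p, h⟩ := h
  refine ⟨M ;; push .qry Γ'.bit ;; setFlag .tmp fun _ _ => false, p + 2,
    fun G hG env hv => ⟨by simp, fun q => ?_⟩⟩
  refine ((h G hG env hv q trivial false (decide (φ G env)) (by simp)).seq
    ((runs_push ..).seq (runs_setFlag ..))).to ?_ (by simp)
  simp only [Prod.mk.injEq, true_and]
  funext k
  cases k <;> simp [store]

/-- The query stack must be empty beforehand, as all of it is submitted. The length bound in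
`Emittable` makes the running time of the oracle, `p'.comp p`, polynomial in the order of the graph.
-/
theorem Emittable.evaluable_ask {w : FinGraph → (ι → ℕ) → List Γ'} (h : Emittable O C X w)
    (e : O.Γ O.k₀ ≃ Γ') (e' : O.Γ O.k₁ ≃ Bool) (p' : Polynomial ℕ)
    (hO : ∀ G ∈ C, ∀ env, Valid G.1 X env → ∀ b : Bool, (b = true ↔ φ G env) →
      Nonempty (TM2OutputsInTime O ((w G env).map e.symm) (some ((encodeBool b).map e'.symm))
        (p'.eval (w G env).length))) :
    Evaluable O C {[]} X φ := by
  obtain ⟨M, p, h⟩ := h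
  refine ⟨setFlag .tmp (fun _ _ => false) ;; M ;; ask e e', p + p * 2 + p'.comp p + 3,
    fun G hG env hv q hq b b' hb => ?_⟩
  obtain rfl : q = [] := hq
  obtain ⟨hO⟩ := hO G hG env hv b' hb
  have hlen := (h G hG env hv).1
  have hmono : p'.eval (w G env).length ≤ p'.eval (p.eval G.1) := eval_mono p' hlen
  refine ((runs_setFlag ..).seq (((h G hG env hv).2 []).seq
    (runs_ask e e' hO false _ (by simp [store])))).to ?_ (by simp; lia)
  simp only [Prod.mk.injEq, true_and]
  funext k
  cases k <;> simp [store]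

end Formulas

end Bondage

namespace Bondage

open Turing Turing.TM2 Computability Function

/-! ### Atomic formulas: equality and matrix lookup. -/

section Atoms

variable {ι : Type} [DecidableEq ι] {O : FinTM2} {C : Set FinGraph} {Q : Set (List Γ')}
  {X : Finset ι}

/-- Compare the values of two variables. -/
def compare (x y : ι) : Prog ι O :=
  setFlag .tmp (fun _ _ => true) ;;
  whileDo (.var x) nonempty (move (.var x) .tmp ;;
    cond (.var y) nonempty (move (.var y) .aux) (setFlag .tmp fun _ _ => false)) ;;
  setFlag (.var y) (fun b o => b && !o.isSome) ;;
  moveAll .tmp (.var x) ;; moveAll .aux (.var y)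

theorem runs_compare {x y : ι} (hxy : x ≠ y) (b : Bool) (s : Reg ι → List Γ') (m n : ℕ)
    (hx : s (.var x) = blanks m) (hy : s (.var y) = blanks n) (ht : s .tmp = [])
    (ha : s .aux = []) :
    Runs (compare x y : Prog ι O) (b, s) (decide (m = n), s) (8 * m + 5) := by
  have hloop := runs_whileDo (O := O) (r := .var x) (p := nonempty)
    (M := move (.var x) .tmp ;;
      cond (.var y) nonempty (move (.var y) .aux) (setFlag .tmp fun _ _ => false)) (T := 3)
    -- Both numbers are consumed in parallel. The flag fails once `y` runs out first; at the end `m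
    -- = n` iff the flag holds and nothing is left of `y`.
    (fun i => (decide (i ≤ n), update (update (update (update s (.var x) (blanks (m - i))) .tmp
      (blanks i)) (.var y) (blanks (n - i))) .aux (blanks (min i n)))) m
    (by intro i hi; simp [nonempty, hi, hxy]) (by simp [nonempty, hxy]) (by
      intro i hi
      refine Runs.seq (T' := 2) (runs_move _ _ _ Γ'.blank (blanks (m - (i + 1)))
        (by simp [hxy, blanks_sub hi]) (by simp)) (runs_cond (fun h => ?_) fun h => ?_)
      · have hin : i < n := by simpa [nonempty, hxy.symm] using h
        refine (runs_move _ _ _ Γ'.blank (blanks (n - (i + 1)))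
          (by simp [blanks_sub hin, hxy.symm]) (by simp)).to ?_ le_rfl
        refine Prod.ext (by simp; lia) ?_
        funext k
        have h₁ : min i n = i := by lia
        have h₂ : min (i + 1) n = i + 1 := by lia
        simp only [update_apply, h₁, h₂]
        split_ifs <;> simp_all [blanks_succ]
      · have hin : n ≤ i := by simpa [nonempty, hxy.symm] using h
        refine (runs_setFlag ..).to ?_ le_rfl
        refine Prod.ext (by simp; lia) ?_
        funext k
        have h₁ : min i n = n := by lia
        have h₂ : min (i + 1) n = n := by lia
        have h₃ : n - i = 0 := by lia
        have h₄ : n - (i + 1) = 0 := by lia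
        simp only [update_apply, h₁, h₂, h₃, h₄]
        split_ifs <;> simp_all [blanks_succ])
  refine ((runs_setFlag ..).seq ((hloop.of_eq (s'' := (true, s)) ?_).seq
    ((runs_setFlag ..).seq ((runs_moveAll (by simp) ..).seq (runs_moveAll (by simp) ..))))).to ?_
    (by simp; lia)
  · refine Prod.ext (by simp) ?_
    clear hloop
    funext k
    simp only [update_apply]
    split_ifs <;> simp_all
  · refine Prod.ext (by simp; grind) ?_
    clear hloop
    funext k
    by_cases h₁ : k = .aux
    · simp [h₁, ha]
    by_cases h₂ : k = .tmp
    · simp [h₂, ht]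
    by_cases h₃ : k = .var x
    · simp [h₃, hxy, hx]
    by_cases h₄ : k = .var y
    · simp only [h₄, ne_eq, reduceCtorEq, not_false_eq_true, update_of_ne, update_self,
        Reg.var.injEq, hxy.symm, reverse_blanks, blanks_append_blanks, hy]
      congr 1
      lia
    simp [h₁, h₂, h₃, h₄]

/-- Comparison needs two distinct stacks, hence the case `x = y` apart. Its time depends on the
value of `x` alone, so only `x` has to be bound to a vertex. -/
theorem Evaluable.eq {x y : ι} (hx : x ∈ X) :
    Evaluable O C Q X fun _ env => env x = env y := by
  by_cases hxy : x = y
  · subst hxy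
    exact (Evaluable.const True).congr (by simp)
  · refine ⟨compare x y, 8 * .X + 5, fun G hG env hv q hq b b' hb => ?_⟩
    refine (runs_compare hxy b _ (env x) (env y) rfl rfl rfl rfl).to ?_ ?_
    · cases b' <;> simp_all
    · have := hv.1 x hx
      simp
      lia

/-- Pour the stack `inp` onto the stack `aux`, up to and including the first comma. -/
def skipRow : Prog ι O :=
  whileDo .inp (fun _ o => o != some Γ'.comma) (move .inp .aux) ;; move .inp .aux

theorem runs_skipRow (b : Bool) (s : Reg ι → List Γ') (u w : List Γ') (hu : Γ'.comma ∉ u)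
    (hs : s .inp = u ++ Γ'.comma :: w) :
    Runs (skipRow : Prog ι O) (b, s)
      (b, update (update s .inp w) .aux ((u ++ [Γ'.comma]).reverse ++ s .aux))
      (2 * u.length + 2) := by
  have key : ∀ (u : List Γ') (s : Reg ι → List Γ'), Γ'.comma ∉ u → s .inp = u ++ Γ'.comma :: w →
      Runs (whileDo .inp (fun _ o => o != some Γ'.comma) (move .inp .aux) : Prog ι O) (b, s)
      (b, update (update s .inp (Γ'.comma :: w)) .aux (u.reverse ++ s .aux))
      (2 * u.length + 1) := by
    intro u
    induction u with
    | nil =>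
      intro s _ hs
      refine (runs_whileDo_stop (by simp [hs])).to ?_ (by simp)
      simp only [Prod.mk.injEq, true_and]
      funext k
      simp only [update_apply]
      split_ifs <;> simp_all
    | cons a u ih =>
      intro s hu hs
      have ha : a ≠ Γ'.comma := by rintro rfl; simp at hu
      have hu' : Γ'.comma ∉ u := fun h => hu (by simp [h])
      refine (runs_whileDo_next (by simpa [hs] using ha)
        (runs_move .inp .aux (b, s) a (u ++ Γ'.comma :: w) hs (by simp))
        (ih _ hu' (by simp))).to ?_ (by simp; lia)
      simp only [Prod.mk.injEq, true_and]
      funext k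
      simp only [update_apply]
      split_ifs <;> simp_all
  refine ((key u s hu hs).seq (runs_move .inp .aux _ Γ'.comma w (by simp) (by simp))).to ?_
    (by simp)
  simp only [Prod.mk.injEq, true_and]
  funext k
  simp only [update_apply]
  split_ifs <;> simp_all

/-- Look up an entry of the adjacency matrix. -/
def lookup (x y : ι) : Prog ι O :=
  (whileDo (.var x) nonempty (move (.var x) .tmp ;; skipRow) ;; moveAll .tmp (.var x)) ;;
  whileDo (.var y) nonempty (move (.var y) .tmp ;; move .inp .aux) ;;
  setFlag .inp (fun _ o => o == some (Γ'.bit true)) ;; moveAll .tmp (.var y) ;; moveAll .aux .inp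

theorem runs_lookup (x y : ι) (b : Bool) (s : Reg ι → List Γ') (m n N : ℕ)
    (R : List (List Γ')) (hR : s .inp = (R.map (· ++ [Γ'.comma])).flatten)
    (hcomma : ∀ u ∈ R, Γ'.comma ∉ u) (hN : ∀ u ∈ R, u.length ≤ N) (hm : m < R.length)
    (hn : n < (R[m]).length) (hx : s (.var x) = blanks m) (hy : s (.var y) = blanks n)
    (ht : s .tmp = []) (ha : s .aux = []) :
    Runs (lookup x y : Prog ι O) (b, s) (R[m][n] == Γ'.bit true, s)
      (4 * N * m + 20 * m + 20 * N + 20) := by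
  set R' := R.map (· ++ [Γ'.comma]) with hR'
  have hlen : R'.length = R.length := by simp [hR']
  have h₁ := runs_whileDo (O := O) (r := .var x) (p := nonempty)
    (M := move (.var x) .tmp ;; skipRow) (T := 2 * N + 3)
    -- After `i` rounds the first `i` rows lie reversed on `aux`, so that pouring `aux` back at the
    -- very end restores the input.
    (fun i => (b, update (update (update (update s (.var x) (blanks (m - i))) .tmp
      (blanks i)) .inp (R'.drop i).flatten) .aux (R'.take i).flatten.reverse)) m
    (by intro i hi; simp [nonempty, hi]) (by simp [nonempty]) (by
      intro i hi
      have hi' : i < R.length := by lia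
      have hd : R'.drop i = (R[i] ++ [Γ'.comma]) :: R'.drop (i + 1) := by
        rw [List.drop_eq_getElem_cons (by lia)]
        simp [hR']
      have htk : R'.take (i + 1) = R'.take i ++ [R[i] ++ [Γ'.comma]] := by
        rw [← List.take_append_getElem (by lia)]
        simp [hR']
      refine ((runs_move _ _ _ Γ'.blank (blanks (m - (i + 1)))
        (by simp [blanks_sub hi]) (by simp)).seq (runs_skipRow _ _ R[i] (R'.drop (i + 1)).flatten
          (hcomma _ (List.getElem_mem _)) (by simp [hd]))).to ?_
        (by have := hN _ (List.getElem_mem hi'); lia)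
      simp only [Prod.mk.injEq, true_and]
      funext k
      simp only [update_apply, htk]
      split_ifs <;> simp_all [blanks_succ])
  set s₁ := update (update s .inp (R'.drop m).flatten) .aux (R'.take m).flatten.reverse with hs₁
  have h₂ : Runs (whileDo (.var x) nonempty (move (.var x) .tmp ;; skipRow) ;;
      moveAll .tmp (.var x) : Prog ι O) (b, s) (b, s₁) (m * (2 * N + 4) + 1 + (2 * m + 1)) := by
    refine ((h₁.of_eq (s'' := (b, s)) ?_).seq (runs_moveAll (by simp) ..)).to ?_ (by simp)
    · refine Prod.ext rfl ?_
      clear h₁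
      funext k
      simp only [update_apply]
      split_ifs <;> simp_all
    · simp only [Prod.mk.injEq, true_and, hs₁]
      funext k
      simp only [update_apply]
      split_ifs <;> simp_all
  -- The input now starts with row `m`; `w` is all that follows, and is never touched.
  obtain ⟨w, hw⟩ : ∃ w, (R'.drop m).flatten = R[m] ++ w := by
    rw [List.drop_eq_getElem_cons (by lia)]
    simp [hR']
  have h₃ := runs_whileDo (O := O) (r := .var y) (p := nonempty)
    (M := move (.var y) .tmp ;; move .inp .aux) (T := 2)
    (fun i => (b, update (update (update (update s₁ (.var y) (blanks (n - i))) .tmp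
      (blanks i)) .inp (R[m].drop i ++ w)) .aux ((R[m].take i).reverse ++ s₁ .aux))) n
    (by intro i hi; simp [nonempty, hi]) (by simp [nonempty]) (by
      intro i hi
      have hi' : i < R[m].length := by lia
      refine ((runs_move _ _ _ Γ'.blank (blanks (n - (i + 1)))
        (by simp [blanks_sub hi]) (by simp)).seq (runs_move _ _ _ R[m][i]
          (R[m].drop (i + 1) ++ w) ?_ (by simp))).to ?_ le_rfl
      · simp only [ne_eq, reduceCtorEq, not_false_eq_true, update_of_ne, update_self]
        rw [List.drop_eq_getElem_cons hi', List.cons_append]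
      · simp only [Prod.mk.injEq, true_and]
        have htk : (R[m].take (i + 1)).reverse = R[m][i] :: (R[m].take i).reverse := by
          rw [← List.take_append_getElem hi']
          simp
        funext k
        simp only [update_apply, htk]
        split_ifs <;> simp_all [blanks_succ])
  have hn' : n ≤ N := hn.le.trans (hN _ (List.getElem_mem _))
  have hlen' : (R'.take m).flatten.length ≤ m * (N + 1) := by
    rw [List.length_flatten]
    refine (List.sum_le_card_nsmul _ (N + 1) ?_).trans ?_
    · intro l hl
      obtain ⟨u, hu, rfl⟩ := List.mem_map.1 hl
      obtain ⟨u', hu', rfl⟩ := List.mem_map.1 (hR' ▸ List.mem_of_mem_take hu)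
      simpa using hN u' hu'
    · simp only [List.length_map, List.length_take, smul_eq_mul]
      gcongr
      exact min_le_left ..
  have h₄ : Runs (whileDo (.var y) nonempty (move (.var y) .tmp ;; move .inp .aux) ;;
      setFlag .inp (fun _ o => o == some (Γ'.bit true)) ;; moveAll .tmp (.var y) ;;
      moveAll .aux .inp : Prog ι O) (b, s₁) (R[m][n] == Γ'.bit true, s)
      (n * 3 + 1 + (1 + (2 * n + 1 + (2 * (n + m * (N + 1)) + 1)))) := by
    refine ((h₃.of_eq (s'' := (b, s₁)) ?_).seq
      ((runs_setFlag ..).seq ((runs_moveAll (by simp) ..).seq (runs_moveAll (by simp) ..)))).to ?_ ?_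
    · refine Prod.ext rfl ?_
      clear h₁ h₂ h₃
      funext k
      simp only [update_apply]
      split_ifs <;> (try subst k) <;> simp [hy, ht, hs₁, hw]
    · refine Prod.ext ?_ ?_
      · simp only [ne_eq, reduceCtorEq, not_false_eq_true, update_of_ne, update_self]
        rw [List.drop_eq_getElem_cons hn]
        rfl
      · clear h₁ h₂ h₃
        have hin : (R'.take m).flatten ++ (R[m] ++ w) = s .inp := by
          rw [← hw, ← List.flatten_append, List.take_append_drop, hR]
        funext k
        by_cases h₁ : k = .aux
        · simp [h₁, ha]
        by_cases h₂ : k = .tmp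
        · simp [h₂, ht]
        by_cases h₃ : k = .inp
        · simp only [h₃, hs₁, ← hin, ne_eq, reduceCtorEq, not_false_eq_true, update_of_ne,
            update_self, List.reverse_append, List.reverse_reverse, List.append_assoc]
          rw [← List.append_assoc (R[m].take n), List.take_append_drop]
        by_cases h₄ : k = .var y
        · simp [h₄, hy]
        simp [h₁, h₂, h₃, h₄, hs₁]
    · simp [hs₁] at hlen' ⊢
      lia
  refine (h₂.seq h₄).mono ?_
  nlinarith

end Atoms

end Bondage

namespace Bondage

open Turing Turing.TM2 Computability Function

/-! ### Adjacency, binary numbers, and reading the input. -/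

section Atoms

variable {ι : Type} [DecidableEq ι] {O : FinTM2} {C : Set FinGraph} {Q : Set (List Γ')}
  {X : Finset ι}

open scoped Classical in
theorem Evaluable.adj {x y : ι} (hx : x ∈ X) (hy : y ∈ X) :
    Evaluable O C Q X fun G env => ∃ (h : env x < G.1) (h' : env y < G.1),
      G.2.Adj ⟨env x, h⟩ ⟨env y, h'⟩ := by
  refine ⟨lookup x y, 4 * .X * .X + 40 * .X + 20, fun G hG env hv q hq b b' hb => ?_⟩
  have hx' := hv.1 x hx
  have hy' := hv.1 y hy
  refine (runs_lookup x y b _ (env x) (env y) G.1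
    ((List.finRange G.1).map fun i => (List.finRange G.1).map fun j =>
      Γ'.bit (decide (G.2.Adj i j))) ?_ ?_ ?_ ?_ ?_ rfl rfl rfl rfl).to ?_ ?_
  · simp [store, encodeGraph, List.flatMap_def, Function.comp_def]
  · simp
  · simp
  · simpa using hx'
  · simpa using hy'
  · refine Prod.ext ?_ rfl
    simp only [hx', hy', exists_true_left] at hb
    cases b' <;> simp_all
  · simp
    nlinarith

/-- The code lists the least significant bit first, as the constructors `bit0` and `bit1` do. So
repeated halving produces the bits in the order in which they must be pushed. -/
theorem encodeNat_succ (n : ℕ) :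
    encodeNat (n + 1) = decide ((n + 1) % 2 = 1) :: encodeNat ((n + 1) / 2) := by
  have hpos : ∀ p : PosNum, encodeNat (p : ℕ) = encodePosNum p := fun p => by
    rw [encodeNat, PosNum.of_to_nat, encodeNum]
  have key : ∀ p : PosNum, encodeNat (p : ℕ) =
      decide ((p : ℕ) % 2 = 1) :: encodeNat ((p : ℕ) / 2) := by
    intro p
    rw [hpos]
    rcases p with _ | p | p
    · rfl
    · have h₁ : ((p.bit1 : PosNum) : ℕ) = 2 * p + 1 := by rw [PosNum.cast_bit1]; ring
      have h₂ : (2 * (p : ℕ) + 1) / 2 = p := by lia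
      simp [encodePosNum, h₁, h₂, hpos]
    · have h₁ : ((p.bit0 : PosNum) : ℕ) = 2 * p := by rw [PosNum.cast_bit0]; ring
      simp [encodePosNum, h₁, hpos]
  have h := Num.to_of_nat (n + 1)
  rcases hp : ((n + 1 : ℕ) : Num) with _ | p
  · rw [hp] at h
    simp at h
  · rw [hp, Num.cast_pos] at h
    rw [← h]
    exact key p

/-- Push the parity of the unary number on `aux` on the query stack and halve the number. -/
def halve : Prog ι O :=
  (whileDo .aux nonempty (pop .aux ;; setFlag .tmp (fun b _ => !b) ;;
    cond .tmp (fun b _ => b) skip (push .tmp fun _ => Γ'.blank))) ;;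
  push .qry Γ'.bit ;; setFlag .tmp (fun _ _ => false) ;; moveAll .tmp .aux

theorem runs_halve (s : Reg ι → List Γ') (n : ℕ) (ha : s .aux = blanks n) (ht : s .tmp = []) :
    Runs (halve : Prog ι O) (false, s) (false, update (update s .aux (blanks (n / 2))) .qry
      (Γ'.bit (decide (n % 2 = 1)) :: s .qry)) (6 * n + 4) := by
  have hloop := runs_whileDo (O := O) (r := .aux) (p := nonempty)
    (M := pop .aux ;; setFlag .tmp (fun b _ => !b) ;;
      cond .tmp (fun b _ => b) skip (push .tmp fun _ => Γ'.blank)) (T := 4)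
    -- The flag is the parity of the number of pops, and every second pop contributes a symbol to
    -- the half.
    (fun i => (decide (i % 2 = 1), update (update s .aux (blanks (n - i))) .tmp
      (blanks (i / 2)))) n
    (by intro i hi; simp [nonempty, hi]) (by simp [nonempty]) (by
      intro i hi
      refine (runs_pop ..).seq ((runs_setFlag ..).seq (T' := 2) (runs_cond (fun h => ?_)
        fun h => ?_))
      · have hi : i % 2 = 0 := by simpa using h
        have h₁ : (i + 1) % 2 = 1 := by lia
        have h₂ : (i + 1) / 2 = i / 2 := by lia
        refine (runs_skip ..).to ?_ le_rfl
        refine Prod.ext (by simp [hi, h₁]) ?_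
        funext k
        simp only [update_apply, h₂]
        split_ifs <;> simp_all [Nat.sub_sub]
      · have hi : i % 2 = 1 := by simpa using h
        have h₁ : (i + 1) % 2 = 0 := by lia
        have h₂ : (i + 1) / 2 = i / 2 + 1 := by lia
        refine (runs_push ..).to ?_ le_rfl
        refine Prod.ext (by simp [hi, h₁]) ?_
        funext k
        simp only [update_apply, h₂]
        split_ifs <;> simp_all [Nat.sub_sub, blanks_succ])
  refine ((hloop.of_eq (s'' := (false, s)) ?_).seq ((runs_push ..).seq
    ((runs_setFlag ..).seq (runs_moveAll (by simp) ..)))).to ?_ (by simp; lia)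
  · refine Prod.ext rfl ?_
    clear hloop
    funext k
    simp only [update_apply]
    split_ifs <;> simp_all
  · refine Prod.ext rfl ?_
    clear hloop
    funext k
    simp only [update_apply]
    split_ifs <;> simp_all

theorem runs_binary (n : ℕ) (s : Reg ι → List Γ') (ha : s .aux = blanks n) (ht : s .tmp = []) :
    Runs (whileDo .aux nonempty halve : Prog ι O) (false, s) (false, update (update s .aux [])
      .qry (((encodeNat n).map Γ'.bit).reverse ++ s .qry)) (n * (6 * n + 5) + 1) := by
  induction n using Nat.strong_induction_on generalizing s with
  | _ n ih =>
    rcases n with _ | n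
    · refine (runs_whileDo_stop (by simp [ha, nonempty])).to ?_ (by simp)
      refine Prod.ext rfl ?_
      funext k
      simp only [update_apply]
      split_ifs <;> simp_all [encodeNat, encodeNum]
    · have h := ih ((n + 1) / 2) (by lia) (update (update s .aux (blanks ((n + 1) / 2))) .qry
        (Γ'.bit (decide ((n + 1) % 2 = 1)) :: s .qry)) (by simp) (by simpa using ht)
      refine (runs_whileDo_next (by simp [ha, nonempty]) (runs_halve s (n + 1) ha ht) h).to ?_ ?_
      · refine Prod.ext rfl ?_
        funext k
        rw [encodeNat_succ]
        simp only [update_apply]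
        split_ifs <;> simp_all
      · have h₁ : (n + 1) / 2 ≤ n := by lia
        have h₂ : (n + 1) / 2 * (6 * ((n + 1) / 2) + 5) ≤ n * (6 * (n + 1) + 5) := by
          gcongr; lia
        lia

theorem length_encodeNat_le (n : ℕ) : (encodeNat n).length ≤ n := by
  induction n using Nat.strong_induction_on with
  | _ n ih =>
    rcases n with _ | n
    · simp [encodeNat, encodeNum]
    · have := ih ((n + 1) / 2) (by lia)
      rw [encodeNat_succ, List.length_cons]
      lia

/-- Variables range over `0, …, n - 1`; the shift by one gives the integers `1, …, n`, as Dominating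
Set requires `k ≥ 1`. -/
theorem Emittable.encodeNat {x : ι} (hx : x ∈ X) :
    Emittable O C X fun _ env => (encodeNat (env x + 1)).map Γ'.bit := by
  refine ⟨addTo (.var x) .tmp .aux ;; push .aux (fun _ => Γ'.blank) ;;
    whileDo .aux nonempty halve, (.X + 1) * (6 * .X + 20), fun G hG env hv => ⟨?_, fun q => ?_⟩⟩
  · have := length_encodeNat_le (env x + 1)
    have := hv.1 x hx
    simp
    nlinarith
  · have hx' := hv.1 x hx
    refine ((runs_addTo (by simp) (by simp) (by simp) _ _ (env x) rfl rfl).seq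
      ((runs_push ..).seq (runs_binary (env x + 1) _ (by simp [store, blanks_succ]) ?_))).to ?_ ?_
    · simp [store]
    · refine Prod.ext rfl ?_
      funext k
      cases k <;> simp [store]
    · simp
      nlinarith

/-- Count the vertices of the input graph. -/
def prelude : Prog ι O :=
  whileDo .inp nonempty (cond .inp (fun _ o => o == some Γ'.comma) (push .cnt fun _ => Γ'.blank)
    skip ;; move .inp .aux) ;; moveAll .aux .inp

theorem runs_prelude (b : Bool) (s : Reg ι → List Γ') (ha : s .aux = []) :
    Runs (prelude : Prog ι O) (b, s)
      (b, update s .cnt (blanks ((s .inp).count Γ'.comma) ++ s .cnt))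
      (6 * (s .inp).length + 2) := by
  have key : ∀ (w : List Γ') (s : Reg ι → List Γ'), s .inp = w →
      Runs (whileDo .inp nonempty (cond .inp (fun _ o => o == some Γ'.comma)
        (push .cnt fun _ => Γ'.blank) skip ;; move .inp .aux) : Prog ι O) (b, s)
      (b, update (update (update s .inp []) .aux (w.reverse ++ s .aux)) .cnt
        (blanks (w.count Γ'.comma) ++ s .cnt)) (4 * w.length + 1) := by
    intro w
    induction w with
    | nil =>
      intro s hs
      refine (runs_whileDo_stop (by simp [hs, nonempty])).to ?_ (by simp)
      refine Prod.ext rfl ?_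
      funext k
      simp only [update_apply]
      split_ifs <;> simp_all
    | cons a w ih =>
      intro s hs
      have h₁ : Runs (cond .inp (fun _ o => o == some Γ'.comma)
          (push .cnt fun _ => Γ'.blank) skip : Prog ι O) (b, s)
          (b, update s .cnt (blanks (List.count Γ'.comma [a]) ++ s .cnt)) 2 := by
        refine runs_cond (fun h => ?_) fun h => ?_
        · have ha : a = Γ'.comma := by simpa [hs] using h
          exact (runs_push ..).to (by simp [ha, blanks_succ]) le_rfl
        · have ha : a ≠ Γ'.comma := by simpa [hs] using h
          exact (runs_skip ..).to (by simp [ha]) le_rfl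
      refine (runs_whileDo_next (by simp [hs, nonempty])
        (h₁.seq (runs_move _ _ _ a w (by simpa using hs) (by simp)))
        (ih _ (by simp))).to ?_ (by simp; lia)
      refine Prod.ext rfl ?_
      have hc : List.count Γ'.comma (a :: w) = List.count Γ'.comma w + List.count Γ'.comma [a] := by
        rw [← List.count_append, List.count_append, add_comm, ← List.count_append]; rfl
      funext k
      simp only [update_apply, hc]
      split_ifs <;> simp_all [← blanks_append_blanks]
  refine ((key _ s rfl).seq (runs_moveAll (by simp) ..)).to ?_ (by simp [ha]; lia)
  refine Prod.ext rfl ?_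
  funext k
  simp only [update_apply]
  split_ifs <;> simp_all

/-- Each row ends with exactly one comma, which is how `prelude` finds the order of the graph. -/
theorem count_comma_encodeGraph (G : FinGraph) : (encodeGraph G).count Γ'.comma = G.1 := by
  classical
  simp only [encodeGraph, List.count_flatMap, Function.comp_def, List.count_append]
  have : ∀ i : Fin G.1, List.count Γ'.comma ((List.finRange G.1).map fun j =>
      Γ'.bit (decide (G.2.Adj i j))) = 0 := fun i => List.count_eq_zero_of_not_mem (by simp)
  simp [this]

theorem le_length_encodeGraph (G : FinGraph) : G.1 ≤ (encodeGraph G).length :=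
  (count_comma_encodeGraph G).symm.le.trans List.count_le_length

theorem Evaluable.solvable [Fintype ι] {φ : FinGraph → (ι → ℕ) → Prop}
    (h : Evaluable O C {[]} ∅ φ) :
    SolvableInPolyTimeOn encodeGraph C fun G => φ G fun _ => 0 := by
  obtain ⟨M, p, h⟩ := h
  refine solvable_of_runs (prelude ;; M ;; clear .inp ;; clear .cnt) (p + 10 * .X + 4)
    fun G hG b hb => ?_
  have hn := le_length_encodeGraph G
  have hp := eval_mono p hn
  have h₁ := h G hG (fun _ => 0) ⟨by simp, by simp⟩ [] rfl false b hb
  refine ((runs_prelude _ _ (by simp)).seq ((h₁.of_eq ?_).seq ((runs_clear ..).seq (runs_clear ..)))).to ?_ ?_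
  · refine Prod.ext rfl ?_
    funext k
    rcases k with _ | _ | _ | _ | _ | _ | _ <;> simp [store, count_comma_encodeGraph]
  · refine Prod.ext rfl ?_
    funext k
    rcases k with _ | _ | _ | _ | _ | _ | _ <;> simp [store]
  · simp [store]
    lia

end Atoms

end Bondage

namespace Bondage

/-! ### Domination and bondage: the graph theory. -/

section Domination

variable {V W κ : Type*}

theorem IsDominating.mono {G G' : SimpleGraph V} (h : G ≤ G') {S : Finset V}
    (hS : IsDominating G S) : IsDominating G' S :=
  fun v => (hS v).imp_right fun ⟨u, hu, hvu⟩ => ⟨u, hu, h hvu⟩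

theorem IsDominating.nonempty [Nonempty V] {G : SimpleGraph V} {S : Finset V}
    (hS : IsDominating G S) : S.Nonempty := by
  obtain ⟨v⟩ := ‹Nonempty V›
  rcases hS v with h | ⟨u, hu, -⟩
  exacts [⟨v, h⟩, ⟨u, hu⟩]

variable [Fintype V] [Fintype W] [Fintype κ]

theorem dominationNumber_le_iff {G : SimpleGraph V} {m : ℕ} :
    dominationNumber G ≤ m ↔ ∃ S : Finset V, IsDominating G S ∧ S.card ≤ m := by
  constructor
  · intro h
    obtain ⟨S, hS, hc⟩ := Nat.sInf_mem (s := {m : ℕ | ∃ S : Finset V, IsDominating G S ∧ S.card = m})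
      ⟨_, Finset.univ, fun v => .inl (Finset.mem_univ v), rfl⟩
    exact ⟨S, hS, hc.trans_le h⟩
  · rintro ⟨S, hS, hc⟩
    have h : S.card ∈ {m : ℕ | ∃ S : Finset V, IsDominating G S ∧ S.card = m} := ⟨S, hS, rfl⟩
    exact (Nat.sInf_le h).trans hc

theorem dominationNumber_le_card (G : SimpleGraph V) : dominationNumber G ≤ Fintype.card V :=
  dominationNumber_le_iff.2 ⟨Finset.univ, fun v => .inl (Finset.mem_univ v), le_rfl⟩

theorem dominationNumber_pos [Nonempty V] (G : SimpleGraph V) : 0 < dominationNumber G := by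
  obtain ⟨S, hS, hc⟩ := dominationNumber_le_iff.1 (le_refl (dominationNumber G))
  exact hS.nonempty.card_pos.trans_le hc

theorem dominationNumber_le_of_iso {G : SimpleGraph V} {G' : SimpleGraph W} (e : G ≃g G') :
    dominationNumber G' ≤ dominationNumber G := by
  obtain ⟨S, hS, hc⟩ := dominationNumber_le_iff.1 (le_refl (dominationNumber G))
  refine dominationNumber_le_iff.2 ⟨S.map e.toEquiv.toEmbedding, fun w => ?_, by simpa using hc⟩
  rcases hS (e.symm w) with h | ⟨u, hu, hwu⟩
  · exact .inl (Finset.mem_map.2 ⟨_, h, e.apply_symm_apply w⟩)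
  · refine .inr ⟨e u, Finset.mem_map.2 ⟨_, hu, rfl⟩, ?_⟩
    simpa using e.map_adj_iff.2 hwu

theorem dominationNumber_congr {G : SimpleGraph V} {G' : SimpleGraph W} (e : G ≃g G') :
    dominationNumber G = dominationNumber G' :=
  (dominationNumber_le_of_iso e.symm).antisymm (dominationNumber_le_of_iso e)

theorem dominationNumber_deleteEdges_singleton_le (G : SimpleGraph V) (e : Sym2 V) :
    dominationNumber (G.deleteEdges {e}) ≤ dominationNumber G + 1 := by
  classical
  obtain ⟨S, hS, hc⟩ := dominationNumber_le_iff.1 (le_refl (dominationNumber G))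
  induction e with | _ a b => ?_
  -- By symmetry `b` does not depend on `a` for its domination. Then only `a` can lose its
  -- dominator, and adding `a` to `S` repairs this.
  wlog hab : a ∈ S → b ∈ S generalizing a b
  · rw [Sym2.eq_swap]
    exact this b a (by tauto)
  refine dominationNumber_le_iff.2 ⟨insert a S, fun v => ?_,
    (Finset.card_insert_le ..).trans (by simpa using hc)⟩
  by_cases hv : v ∈ insert a S
  · exact .inl hv
  simp only [Finset.mem_insert, not_or] at hv
  obtain ⟨u, hu, hvu⟩ := (hS v).resolve_left hv.2
  refine .inr ⟨u, Finset.mem_insert_of_mem hu, ?_⟩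
  rw [SimpleGraph.deleteEdges_adj]
  refine ⟨hvu, ?_⟩
  simp only [Set.mem_singleton_iff, Sym2.eq_iff]
  rintro (⟨rfl, rfl⟩ | ⟨rfl, rfl⟩)
  · exact hv.1 rfl
  · exact hv.2 (hab hu)

/-- A discrete intermediate value argument: as single deletions raise `γ` by at most one, any
increase passes through the value `γ(G) + 1`. -/
theorem bondageNumber_le_iff {G : SimpleGraph V} {d : ℕ} :
    bondageNumber G ≤ d ↔ ∃ A : Finset (Sym2 V), A.card ≤ d ∧
      dominationNumber G < dominationNumber (G.deleteEdges (A : Set (Sym2 V))) := by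
  classical
  constructor
  · intro h
    have hne : {m : ℕ∞ | ∃ A : Finset (Sym2 V), (A : Set (Sym2 V)) ⊆ G.edgeSet ∧
        dominationNumber (G.deleteEdges (A : Set (Sym2 V))) = dominationNumber G + 1 ∧
        (A.card : ℕ∞) = m}.Nonempty := by
      by_contra hne
      rw [bondageNumber, Set.not_nonempty_iff_eq_empty.1 hne, sInf_empty] at h
      exact absurd h (by simp)
    obtain ⟨A, -, hA, hc⟩ := csInf_mem hne
    refine ⟨A, ?_, by lia⟩
    have : (A.card : ℕ∞) ≤ d := hc.trans_le h
    exact_mod_cast this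
  · rintro ⟨A, hc, hA⟩
    suffices ∃ B : Finset (Sym2 V), (B : Set (Sym2 V)) ⊆ G.edgeSet ∧ B.card ≤ d ∧
        dominationNumber (G.deleteEdges (B : Set (Sym2 V))) = dominationNumber G + 1 by
      obtain ⟨B, hB, hBc, hBd⟩ := this
      have h : (B.card : ℕ∞) ∈ {m : ℕ∞ | ∃ A : Finset (Sym2 V), (A : Set (Sym2 V)) ⊆ G.edgeSet ∧
          dominationNumber (G.deleteEdges (A : Set (Sym2 V))) = dominationNumber G + 1 ∧
          (A.card : ℕ∞) = m} := ⟨B, hB, hBd, rfl⟩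
      exact (sInf_le h).trans (by exact_mod_cast hBc)
    induction A using Finset.induction_on with
    | empty => simp at hA
    | insert e A he ih =>
      rw [Finset.card_insert_of_notMem he] at hc
      by_cases h : dominationNumber G < dominationNumber (G.deleteEdges (A : Set (Sym2 V)))
      · exact ih (by lia) h
      · have h₁ := dominationNumber_deleteEdges_singleton_le (G.deleteEdges (A : Set (Sym2 V))) e
        rw [SimpleGraph.deleteEdges_deleteEdges] at h₁
        rw [Finset.coe_insert, Set.insert_eq, Set.union_comm] at hA
        -- Without `e` there was no increase, so `e` raises `γ` by exactly one. Members of the set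
        -- that are not edges of `G` are discarded, which does not change the deleted graph.
        refine ⟨(insert e A).filter (· ∈ G.edgeSet), fun x hx => by simpa using (by simpa using hx : _ ∧ _).2,
          (Finset.card_filter_le ..).trans ?_, ?_⟩
        · rwa [Finset.card_insert_of_notMem he]
        · have : G.deleteEdges (((insert e A).filter (· ∈ G.edgeSet) : Finset (Sym2 V)) :
              Set (Sym2 V)) = G.deleteEdges ((A : Set (Sym2 V)) ∪ {e}) := by
            ext u v
            simp only [SimpleGraph.deleteEdges_adj, Finset.coe_filter, Finset.mem_insert,
              Set.mem_ofPred_eq, SimpleGraph.mem_edgeSet, Set.mem_union, Set.mem_singleton_iff,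
              Finset.mem_coe]
            tauto
          rw [this]
          lia

theorem exists_range_eq {α : Type*} {S : Finset α} (hS : S.Nonempty) {m : ℕ} (hm : S.card ≤ m) :
    ∃ f : Fin m → α, Set.range f = S := by
  have : Nonempty S := hS.to_subtype
  obtain ⟨g⟩ : Nonempty (S ↪ Fin m) := Function.Embedding.nonempty_of_card_le (by simpa using hm)
  refine ⟨fun l => (Function.invFun g l).1, ?_⟩
  ext a
  constructor
  · rintro ⟨l, rfl⟩
    exact (Function.invFun g l).2
  · intro ha
    exact ⟨g ⟨a, ha⟩, congrArg Subtype.val (Function.leftInverse_invFun g.injective ⟨a, ha⟩)⟩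

/-- The relation of being joined by one of the pairs `(e l, e (d + l))`. -/
def Paired {α : Type*} {d : ℕ} (e : Fin (d + d) → α) (a b : α) : Prop :=
  ∃ l : Fin d, a = e (Fin.castAdd d l) ∧ b = e (Fin.natAdd d l) ∨
    b = e (Fin.castAdd d l) ∧ a = e (Fin.natAdd d l)

/-- Delete the edges that join one of the pairs `(e l, e (d + l))`. -/
def cut {V : Type*} {d : ℕ} (G : SimpleGraph V) (e : Fin (d + d) → V) : SimpleGraph V where
  Adj u v := G.Adj u v ∧ ¬ Paired e u v
  symm := ⟨fun _ _ h => ⟨h.1.symm, fun ⟨l, hl⟩ => h.2 ⟨l, hl.symm⟩⟩⟩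
  loopless := ⟨fun _ h => G.loopless.irrefl _ h.1⟩

theorem cut_eq_deleteEdges {V : Type*} {d : ℕ} (G : SimpleGraph V) (e : Fin (d + d) → V) :
    cut G e = G.deleteEdges
      (Set.range fun l => s(e (Fin.castAdd d l), e (Fin.natAdd d l))) := by
  ext u v
  rw [SimpleGraph.deleteEdges_adj]
  refine and_congr_right (a := G.Adj u v) fun _ => not_congr (exists_congr fun l => ?_)
  rw [Sym2.eq_iff]
  grind

theorem bondageNumber_le_iff_exists_cut {G : SimpleGraph V} {d : ℕ} :
    bondageNumber G ≤ d ↔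
      ∃ e : Fin (d + d) → V, dominationNumber G < dominationNumber (cut G e) := by
  classical
  rw [bondageNumber_le_iff]
  constructor
  · rintro ⟨A, hc, hA⟩
    -- A nonempty set of at most `d` elements can be listed with repetitions as a tuple of length
    -- exactly `d`.
    have hne : A.Nonempty := by
      rw [Finset.nonempty_iff_ne_empty]
      rintro rfl
      simp at hA
    obtain ⟨f, hf⟩ := exists_range_eq hne hc
    have hs : ∀ l, ∃ a b, s(a, b) = f l := fun l => (f l).ind fun a b => ⟨a, b, rfl⟩
    choose a b hab using hs
    refine ⟨Fin.append a b, ?_⟩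
    rw [cut_eq_deleteEdges]
    simp only [Fin.append_left, Fin.append_right, hab, hf]
    exact hA
  · rintro ⟨e, he⟩
    refine ⟨Finset.univ.image fun l => s(e (Fin.castAdd d l), e (Fin.natAdd d l)),
      Finset.card_image_le.trans (by simp), ?_⟩
    rw [cut_eq_deleteEdges] at he
    simpa using he

/-- Attach a pendant vertex to `f l`, for each `l`. -/
def pendant {V κ : Type*} (G : SimpleGraph V) (f : κ → V) : SimpleGraph (V ⊕ κ) where
  Adj
    | .inl u, .inl v => G.Adj u v
    | .inl u, .inr l => u = f l
    | .inr l, .inl u => u = f l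
    | .inr _, .inr _ => False
  symm := ⟨by rintro (u | l) (v | l') h <;> first | exact h.symm | exact h⟩
  loopless := ⟨by rintro (u | l) h <;> first | exact G.loopless.irrefl _ h | exact h⟩

theorem dominationNumber_pendant_le_iff {G : SimpleGraph V} {f : κ → V} {m : ℕ} :
    dominationNumber (pendant G f) ≤ m ↔
      ∃ S : Finset V, IsDominating G S ∧ (∀ l, f l ∈ S) ∧ S.card ≤ m := by
  classical
  rw [dominationNumber_le_iff]
  constructor
  · rintro ⟨T, hT, hc⟩
    -- Replace every pendant vertex in `T` by its only neighbour. Since `T` dominates the pendant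
    -- vertex at `f l`, the new set contains `f l`.
    have hl : ∀ l, f l ∈ T.image (Sum.elim id f) := by
      intro l
      rcases hT (.inr l) with h | ⟨u | l', hu, hlu⟩
      · exact Finset.mem_image.2 ⟨_, h, rfl⟩
      · exact Finset.mem_image.2 ⟨_, hu, hlu⟩
      · exact hlu.elim
    refine ⟨T.image (Sum.elim id f), fun v => ?_, hl, Finset.card_image_le.trans hc⟩
    rcases hT (.inl v) with h | ⟨u | l, hu, hvu⟩
    · exact .inl (Finset.mem_image.2 ⟨_, h, rfl⟩)
    · exact .inr ⟨u, Finset.mem_image.2 ⟨_, hu, rfl⟩, hvu⟩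
    · obtain rfl : v = f l := hvu
      exact .inl (hl l)
  · rintro ⟨S, hS, hf, hc⟩
    refine ⟨S.map .inl, ?_, by simpa using hc⟩
    rintro (v | l)
    · rcases hS v with h | ⟨u, hu, hvu⟩
      · exact .inl (Finset.mem_map.2 ⟨v, h, rfl⟩)
      · exact .inr ⟨.inl u, Finset.mem_map.2 ⟨u, hu, rfl⟩, hvu⟩
    · exact .inr ⟨.inl (f l), Finset.mem_map.2 ⟨_, hf l, rfl⟩, rfl⟩

/-- A dominating set of `G` can fail in `G'` only at the vertices `e l`, since all others keep their
neighbours. Choosing a dominator `f l` of each `e l` in `G'`, and forcing it into the set by a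
pendant vertex, excludes such failures. -/
theorem dominationNumber_le_iff_exists_pendant {G G' : SimpleGraph V} (hG : G' ≤ G) (e : κ → V)
    (he : ∀ v, (∀ l, e l ≠ v) → ∀ u, G.Adj v u → G'.Adj v u) {m : ℕ} :
    dominationNumber G' ≤ m ↔ ∃ f : κ → V, (∀ l, f l = e l ∨ G'.Adj (e l) (f l)) ∧
      dominationNumber (pendant G f) ≤ m := by
  simp only [dominationNumber_pendant_le_iff]
  rw [dominationNumber_le_iff]
  constructor
  · rintro ⟨S, hS, hc⟩
    have : ∀ l, ∃ u ∈ S, u = e l ∨ G'.Adj (e l) u := by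
      intro l
      rcases hS (e l) with h | ⟨u, hu, h⟩
      exacts [⟨_, h, .inl rfl⟩, ⟨u, hu, .inr h⟩]
    choose f hfS hf using this
    exact ⟨f, hf, S, hS.mono hG, hfS, hc⟩
  · rintro ⟨f, hf, S, hS, hfS, hc⟩
    refine ⟨S, fun v => ?_, hc⟩
    by_cases hv : ∀ l, e l ≠ v
    · exact (hS v).imp_right fun ⟨u, hu, hvu⟩ => ⟨u, hu, he v hv u hvu⟩
    · push Not at hv
      obtain ⟨l, rfl⟩ := hv
      rcases hf l with h | h
      · exact .inl (h ▸ hfS l)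
      · exact .inr ⟨f l, hfS l, h⟩

theorem dominationNumber_cut_le_iff {G : SimpleGraph V} {d m : ℕ} (e : Fin (d + d) → V) :
    dominationNumber (cut G e) ≤ m ↔ ∃ f : Fin (d + d) → V,
      (∀ l, f l = e l ∨ (cut G e).Adj (e l) (f l)) ∧ dominationNumber (pendant G f) ≤ m := by
  refine dominationNumber_le_iff_exists_pendant (G' := cut G e) (fun _ _ h => h.1) e fun v hv u hvu => ⟨hvu, ?_⟩
  rintro ⟨l, ⟨h, -⟩ | ⟨-, h⟩⟩
  exacts [hv _ h.symm, hv _ h.symm]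

/-- A vertex of `H` mapped to a pendant vertex would have two neighbours with the same image,
contradicting injectivity. So a copy of `H` lies inside `G`. -/
theorem isIndContained_of_pendant {V κ : Type*} {H : SimpleGraph W} [DecidableRel H.Adj]
    (hH : 2 ≤ H.minDegree) {G : SimpleGraph V} {f : κ → V} (h : H.IsIndContained (pendant G f)) :
    H.IsIndContained G := by
  obtain ⟨φ⟩ := h
  have hφ : ∀ w, ∃ v, φ w = .inl v := by
    intro w
    rcases hw : φ w with v | l
    · exact ⟨v, rfl⟩
    · obtain ⟨a, ha, b, hb, hab⟩ := Finset.one_lt_card.1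
        (show 1 < (H.neighborFinset w).card from hH.trans (H.minDegree_le_degree w))
      rw [SimpleGraph.mem_neighborFinset] at ha hb
      have key : ∀ c, H.Adj w c → φ c = .inl (f l) := by
        intro c hc
        have := φ.map_adj_iff.2 hc
        rw [hw] at this
        rcases hc' : φ c with u | l'
        · rw [hc'] at this
          exact congrArg _ this
        · rw [hc'] at this
          exact this.elim
      exact absurd (φ.injective ((key a ha).trans (key b hb).symm)) hab
  choose g hg using hφ
  refine ⟨⟨⟨g, fun a b hab => φ.injective (by rw [hg, hg, hab])⟩, fun {a b} => ?_⟩⟩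
  rw [← φ.map_adj_iff, hg, hg]
  rfl

end Domination

end Bondage

namespace Bondage

open Turing Turing.TM2 Computability Function

/-! ### Writing graphs as queries. -/

section Queries

variable {ι : Type} [DecidableEq ι] {O : FinTM2} {C : Set FinGraph} {Q : Set (List Γ')}
  {X Y : Finset ι} {φ : FinGraph → (ι → ℕ) → Prop}

theorem Evaluable.exists_piecewise (hYX : Disjoint Y X) (h : Evaluable O C Q (Y ∪ X) φ) :
    Evaluable O C Q X fun G env =>
      ∃ f : ι → ℕ, (∀ i ∈ Y, f i < G.1) ∧ φ G (Y.piecewise f env) := by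
  induction Y using Finset.induction_on generalizing φ with
  | empty => simpa using h
  | insert y Y hy ih =>
    rw [Finset.disjoint_insert_left] at hYX
    rw [Finset.insert_union] at h
    refine (ih hYX.2 (h.ex (by simp [hy, hYX.1]))).congr fun G _ env _ => ?_
    constructor
    · rintro ⟨f, hf, v, hv, h⟩
      have hne : ∀ i ∈ Y, i ≠ y := fun i hi => by rintro rfl; exact hy hi
      refine ⟨update f y v, fun i hi => ?_, ?_⟩
      · rcases Finset.mem_insert.1 hi with rfl | hi
        · simpa using hv
        · simpa [hne i hi] using hf i hi
      · rw [Finset.piecewise_insert, update_self,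
          Finset.piecewise_congr Y (fun i hi => update_of_ne (hne i hi) v f)
            fun _ _ => rfl]
        exact h
    · rintro ⟨f, hf, h⟩
      refine ⟨f, fun i hi => hf i (by simp [hi]), f y, hf y (by simp), ?_⟩
      rwa [Finset.piecewise_insert] at h

theorem Valid.piecewise {n : ℕ} {env f : ι → ℕ} (h : Valid n X env) (hf : ∀ i ∈ Y, f i < n) :
    Valid n (Y ∪ X) (Y.piecewise f env) := by
  constructor
  · intro i hi
    by_cases hiY : i ∈ Y
    · simpa [hiY] using hf i hiY
    · simpa [hiY] using h.1 i (by simpa [hiY] using hi)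
  · intro i hi
    rw [Finset.mem_union, not_or] at hi
    simpa [hi.1] using h.2 i hi.2

theorem flatMap_range {α : Type*} (n : ℕ) (F : ℕ → List α) :
    (List.range n).flatMap F = (List.finRange n).flatMap fun u : Fin n => F (u : ℕ) := by
  rw [← List.map_coe_finRange_eq_range, List.flatMap_map]

theorem finRange_add (n c : ℕ) : List.finRange (n + c) =
    (List.finRange n).map (Fin.castAdd c) ++ (List.finRange c).map (Fin.natAdd n) := by
  simp only [← List.ofFn_id, List.map_ofFn]
  rw [List.ofFn_add]
  rfl

open scoped Classical in
/-- The code of a graph on `n + c` vertices whose last `c` vertices are independent. The formula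
`ψ`, in the variables `i` and `j`, describes the adjacency of the first `n` vertices; the formula
`χ l`, in the variable `i`, describes the neighbours of the vertex `n + l`. -/
noncomputable def code (c : ℕ) (i j : ι) (ψ : FinGraph → (ι → ℕ) → Prop)
    (χ : Fin c → FinGraph → (ι → ℕ) → Prop) (G : FinGraph) (env : ι → ℕ) : List Γ' :=
  ((List.range G.1).flatMap fun u =>
    (((List.range G.1).flatMap fun v => [Γ'.bit (decide (ψ G (update (update env i u) j v)))]) ++
      (List.finRange c).flatMap fun l => [Γ'.bit (decide (χ l G (update env i u)))]) ++
        [Γ'.comma]) ++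
  (List.finRange c).flatMap fun l =>
    (((List.range G.1).flatMap fun u => [Γ'.bit (decide (χ l G (update env i u)))]) ++
      (List.finRange c).flatMap fun _ => [Γ'.bit false]) ++ [Γ'.comma]

theorem emittable_code {c : ℕ} {i j : ι} {ψ : FinGraph → (ι → ℕ) → Prop}
    {χ : Fin c → FinGraph → (ι → ℕ) → Prop} (hi : i ∉ X) (hj : j ∉ insert i X)
    (hψ : Evaluable O C Set.univ (insert j (insert i X)) ψ)
    (hχ : ∀ l, Evaluable O C Set.univ (insert i X) (χ l)) :
    Emittable O C X (code c i j ψ χ) :=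
  (Emittable.flatMap (((hψ.bit.flatMap hj).append
    (Emittable.flatMap_list _ fun l _ => (hχ l).bit)).append (.singleton _)) hi).append
  (Emittable.flatMap_list _ fun l _ => (((hχ l).bit.flatMap hi).append
    (Emittable.flatMap_list _ fun _ _ => .singleton _)).append (.singleton _))

-- The adjacency matrix splits into four blocks: `ψ`, the columns `χ l`, by symmetry the rows `χ l`,
-- and a zero block.
open scoped Classical in
theorem code_eq {c : ℕ} {i j : ι} {ψ : FinGraph → (ι → ℕ) → Prop}
    {χ : Fin c → FinGraph → (ι → ℕ) → Prop} {G : FinGraph} {env : ι → ℕ}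
    (H : SimpleGraph (Fin (G.1 + c)))
    (h₀ : ∀ u v : Fin G.1, H.Adj (u.castAdd c) (v.castAdd c) ↔
      ψ G (update (update env i u) j v))
    (h₁ : ∀ (u : Fin G.1) (l : Fin c), H.Adj (u.castAdd c) (l.natAdd G.1) ↔
      χ l G (update env i u))
    (h₂ : ∀ l l' : Fin c, ¬ H.Adj (l.natAdd G.1) (l'.natAdd G.1)) :
    code c i j ψ χ G env = encodeGraph ⟨G.1 + c, H⟩ := by
  have h₁' : ∀ (u : Fin G.1) (l : Fin c), H.Adj (l.natAdd G.1) (u.castAdd c) ↔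
      χ l G (update env i u) := fun u l => by rw [H.adj_comm, h₁]
  have key : ∀ {p q : Prop}, (p ↔ q) → decide p = decide q := fun h => decide_eq_decide.2 h
  have key' : ∀ {p : Prop}, ¬ p → decide p = false := fun h => decide_eq_false h
  have e₀ := fun u v => key (h₀ u v)
  have e₁ := fun u l => key (h₁ u l)
  have e₁' := fun u l => key (h₁' u l)
  have e₂ := fun l l' => key' (h₂ l l')
  simp only [code, flatMap_range]
  simp only [encodeGraph, finRange_add, List.flatMap_append, List.map_append, List.flatMap_map,
    List.map_map, Function.comp_def, List.append_assoc]
  simp only [e₀, e₁, e₁', e₂, List.map_eq_flatMap]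

theorem evaluable_dominationNumber_le {C' : Set FinGraph}
    (M : TM2ComputableInPolyTime
      (fun a : {x : FinGraph × ℕ | x.1 ∈ C' ∧ 1 ≤ x.2} => encodeGraphNat a) encodeBool
      (fun a => @decide (dominationNumber a.1.1.2 ≤ a.1.2) (Classical.propDecidable _)))
    {w : FinGraph → (ι → ℕ) → List Γ'} (hw : Emittable M.tm C X w) {x : ι} (hx : x ∈ X)
    (h : ∀ G ∈ C, ∀ env, Valid G.1 X env → ∃ H ∈ C', w G env = encodeGraph H ∧
      (dominationNumber H.2 ≤ env x + 1 ↔ φ G env)) :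
    Evaluable M.tm C {[]} X φ := by
  refine (hw.append ((Emittable.singleton Γ'.ket).append (.encodeNat hx))).evaluable_ask
    M.inputAlphabet M.outputAlphabet M.time fun G hG env hv b hb => ?_
  obtain ⟨H, hH, hwH, hφ⟩ := h G hG env hv
  have hout := M.outputsFun ⟨(H, env x + 1), hH, by simp⟩
  have hb' : @decide (dominationNumber H.2 ≤ env x + 1) (Classical.propDecidable _) = b := by
    rw [Bool.eq_iff_iff, hb]
    exact (@decide_eq_true_iff _ (Classical.propDecidable _)).trans hφ
  refine ⟨?_⟩
  simp only [hb'] at hout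
  simpa [hwH, encodeGraphNat] using hout

end Queries

/-! ### The reduction common to all three cases. -/

section Reduction

/-- The variables: an integer, two vertices for writing adjacency matrices, and two tuples. -/
abbrev Vars (c m : ℕ) : Type := Fin 3 ⊕ Fin c ⊕ Fin m

/-- The variables that are bound first: the integer and the first tuple. -/
def outer (c m : ℕ) : Finset (Vars c m) :=
  insert (.inl 0) (Finset.univ.image fun l => .inr (.inl l))

/-- The variables that are bound next: the second tuple. -/
def inner (c m : ℕ) : Finset (Vars c m) := Finset.univ.image fun l => .inr (.inr l)

@[simp] theorem mem_outer {c m : ℕ} {i : Vars c m} :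
    i ∈ outer c m ↔ i = .inl 0 ∨ ∃ l, .inr (.inl l) = i := by simp [outer]

@[simp] theorem mem_inner {c m : ℕ} {i : Vars c m} :
    i ∈ inner c m ↔ ∃ l, .inr (.inr l) = i := by simp [inner]

theorem disjoint_inner_outer (c m : ℕ) : Disjoint (inner c m) (outer c m) := by
  rw [Finset.disjoint_left]
  rintro i hi
  obtain ⟨l, rfl⟩ := mem_inner.1 hi
  simp

variable {O : FinTM2} {C : Set FinGraph} {d m : ℕ}

/-- The machine searches for an integer and a tuple `e` satisfying `φ`. Hence `φ` must be sound for
every integer, but complete only when the integer variable is `γ(G) - 1`. -/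
theorem bondagePoly_of_evaluable {φ : FinGraph → (Vars (d + d) m → ℕ) → Prop}
    (h : Evaluable O C {[]} (outer (d + d) m) φ)
    (h₁ : ∀ G ∈ C, ∀ env, Valid G.1 (outer (d + d) m) env → ∀ e : Fin (d + d) → Fin G.1,
      (∀ l, (e l : ℕ) = env (.inr (.inl l))) → φ G env →
      dominationNumber G.2 < dominationNumber (cut G.2 e))
    (h₂ : ∀ G ∈ C, ∀ env, Valid G.1 (outer (d + d) m) env → ∀ e : Fin (d + d) → Fin G.1,
      (∀ l, (e l : ℕ) = env (.inr (.inl l))) → dominationNumber G.2 = env (.inl 0) + 1 →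
      dominationNumber G.2 < dominationNumber (cut G.2 e) → φ G env) :
    BondagePoly d C := by
  rw [← Finset.union_empty (outer (d + d) m)] at h
  refine Evaluable.solvable (φ := fun G _ => bondageNumber G.2 ≤ (d : ℕ∞))
    ((h.exists_piecewise (by simp)).congr fun G hG env hv => ?_)
  rw [bondageNumber_le_iff_exists_cut]
  have hv' : ∀ f : Vars (d + d) m → ℕ, (∀ i ∈ outer (d + d) m, f i < G.1) →
      Valid G.1 (outer (d + d) m) ((outer (d + d) m).piecewise f env) := fun f hf => by
    simpa using hv.piecewise hf
  constructor
  · rintro ⟨f, hf, h⟩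
    exact ⟨fun l => ⟨f (.inr (.inl l)), hf _ (by simp)⟩,
      h₁ G hG _ (hv' f hf) _ (by simp [Finset.piecewise]) h⟩
  · rintro ⟨e, he⟩
    -- The null graph is excluded because `γ` cannot increase there; so `γ(G) - 1` is an admissible
    -- value of a variable.
    have hpos : 0 < dominationNumber G.2 := by
      by_contra h0
      have hc := dominationNumber_le_card (cut G.2 e)
      rw [Fintype.card_fin] at hc
      have : Nonempty (Fin G.1) := ⟨⟨0, by lia⟩⟩
      exact h0 (dominationNumber_pos G.2)
    have hle := dominationNumber_le_card G.2
    rw [Fintype.card_fin] at hle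
    have hf : ∀ i ∈ outer (d + d) m, (Sum.elim (fun _ => dominationNumber G.2 - 1)
        (Sum.elim (fun l => (e l : ℕ)) fun _ => 0) : Vars (d + d) m → ℕ) i < G.1 := by
      intro i hi
      rcases mem_outer.1 hi with rfl | ⟨l, rfl⟩
      · simp only [Sum.elim_inl]
        lia
      · simp
    refine ⟨_, hf, h₂ G hG _ (hv' _ hf) e (by simp [Finset.piecewise]) ?_ he⟩
    simp [Finset.piecewise]
    lia

section Formulas

variable {Q : Set (List Γ')} {X : Finset (Vars (d + d) m)}

theorem evaluable_paired {a b : Vars (d + d) m} (ha : a ∈ X) (hb : b ∈ X) :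
    Evaluable O C Q X fun _ env => Paired (fun l => env (.inr (.inl l))) (env a) (env b) := by
  refine (Evaluable.exists_mem (List.finRange d) (fun l _ =>
    ((Evaluable.eq (y := .inr (.inl (Fin.castAdd d l))) ha).and
      (Evaluable.eq (y := .inr (.inl (Fin.natAdd d l))) hb)).or
    ((Evaluable.eq (y := .inr (.inl (Fin.castAdd d l))) hb).and
      (Evaluable.eq (y := .inr (.inl (Fin.natAdd d l))) ha)))).congr ?_
  simp [Paired]

/-- The adjacency of two variables in the graph. -/
def adjFormula (a b : Vars (d + d) m) (G : FinGraph) (env : Vars (d + d) m → ℕ) : Prop :=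
  ∃ (h : env a < G.1) (h' : env b < G.1), G.2.Adj ⟨env a, h⟩ ⟨env b, h'⟩

/-- The adjacency of two variables after deletion of the edges given by the first tuple. -/
def cutFormula (a b : Vars (d + d) m) (G : FinGraph) (env : Vars (d + d) m → ℕ) : Prop :=
  adjFormula a b G env ∧ ¬ Paired (fun l => env (.inr (.inl l))) (env a) (env b)

theorem evaluable_adjFormula {a b : Vars (d + d) m} (ha : a ∈ X) (hb : b ∈ X) :
    Evaluable O C Q X (adjFormula a b) := Evaluable.adj ha hb

theorem evaluable_cutFormula {a b : Vars (d + d) m} (ha : a ∈ X) (hb : b ∈ X) :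
    Evaluable O C Q X (cutFormula a b) :=
  (evaluable_adjFormula ha hb).and (evaluable_paired ha hb).not

theorem adjFormula_iff {a b : Vars (d + d) m} {G : FinGraph} {env : Vars (d + d) m → ℕ}
    {u v : Fin G.1} (hu : env a = u) (hv : env b = v) :
    adjFormula a b G env ↔ G.2.Adj u v := by
  simp [adjFormula, hu, hv]

theorem cutFormula_iff {a b : Vars (d + d) m} {G : FinGraph} {env : Vars (d + d) m → ℕ}
    {u v : Fin G.1} (hu : env a = u) (hv : env b = v) {e : Fin (d + d) → Fin G.1}
    (he : ∀ l, (e l : ℕ) = env (.inr (.inl l))) :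
    cutFormula a b G env ↔ (cut G.2 e).Adj u v := by
  simp [cutFormula, adjFormula_iff hu hv, cut, Paired, hu, hv, ← he, Fin.ext_iff]

end Formulas

end Reduction

end Bondage

namespace Bondage

open Turing Turing.TM2 Computability Function

/-! ### The three cases. -/

section Cases

variable {O : FinTM2} {C C' : Set FinGraph} {d m : ℕ}

/-- The code of the graph. -/
noncomputable abbrev graphCode : FinGraph → (Vars (d + d) m → ℕ) → List Γ' :=
  code 0 (.inl 1) (.inl 2) (adjFormula (.inl 1) (.inl 2)) fun l => l.elim0

theorem emittable_graphCode {X : Finset (Vars (d + d) m)} (h₁ : .inl 1 ∉ X) (h₂ : .inl 2 ∉ X) :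
    Emittable O C X (graphCode (d := d) (m := m)) :=
  emittable_code h₁ (by simpa using h₂) (evaluable_adjFormula (by simp) (by simp))
    fun l => l.elim0

theorem graphCode_eq (G : FinGraph) (env : Vars (d + d) m → ℕ) :
    graphCode G env = encodeGraph G :=
  code_eq (c := 0) G.2 (fun u v => (adjFormula_iff (by simp) (by simp)).symm) (fun _ l => l.elim0)
    fun l => l.elim0

theorem ClosedUnderEdgeDeletions.deleteEdges_mem (hC : ClosedUnderEdgeDeletions C) {G : FinGraph}
    (hG : G ∈ C) (A : Finset (Sym2 (Fin G.1))) :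
    (⟨G.1, G.2.deleteEdges (A : Set (Sym2 (Fin G.1)))⟩ : FinGraph) ∈ C := by
  classical
  induction A using Finset.induction_on with
  | empty => simpa using hG
  | insert e A _ ih =>
    have h : G.2.deleteEdges ((insert e A : Finset (Sym2 (Fin G.1))) : Set (Sym2 (Fin G.1))) =
        (G.2.deleteEdges (A : Set (Sym2 (Fin G.1)))).deleteEdges {e} := by
      rw [SimpleGraph.deleteEdges_deleteEdges, Finset.coe_insert, Set.insert_eq, Set.union_comm]
    rw [h]
    by_cases he : e ∈ (G.2.deleteEdges (A : Set (Sym2 (Fin G.1)))).edgeSet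
    · exact hC _ _ ih e he
    · rwa [SimpleGraph.deleteEdges_eq_self.2 (Set.disjoint_singleton_right.2 he)]

theorem ClosedUnderEdgeDeletions.cut_mem (hC : ClosedUnderEdgeDeletions C) {G : FinGraph}
    (hG : G ∈ C) (e : Fin (d + d) → Fin G.1) : (⟨G.1, cut G.2 e⟩ : FinGraph) ∈ C := by
  classical
  have h := hC.deleteEdges_mem hG
    (Finset.univ.image fun l => s(e (Fin.castAdd d l), e (Fin.natAdd d l)))
  rw [cut_eq_deleteEdges]
  simpa using h

theorem bondagePoly_of_closedUnderEdgeDeletions (hC : ClosedUnderEdgeDeletions C)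
    (h : DominatingSetPoly C) : BondagePoly d C := by
  obtain ⟨M⟩ := h
  have hA := evaluable_dominationNumber_le (C := C) (X := outer (d + d) 0)
    (φ := fun G env => dominationNumber G.2 ≤ env (.inl 0) + 1) M
    (emittable_graphCode (by simp) (by simp)) (x := .inl 0) (by simp)
    fun G hG env hv => ⟨G, hG, graphCode_eq G env, Iff.rfl⟩
  have hB := evaluable_dominationNumber_le (C := C) (X := outer (d + d) 0)
    -- The environment holds plain natural numbers; the quantifier only turns them into vertices,
    -- and `e` is determined by `env`.
    (φ := fun G env => ∃ e : Fin (d + d) → Fin G.1, (∀ l, (e l : ℕ) = env (.inr (.inl l))) ∧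
      dominationNumber (cut G.2 e) ≤ env (.inl 0) + 1) M
    (emittable_code (c := 0) (χ := fun l => l.elim0) (i := .inl 1) (j := .inl 2) (by simp) (by simp)
      (evaluable_cutFormula (a := .inl 1) (b := .inl 2) (by simp) (by simp)) fun l => l.elim0)
    (x := .inl 0) (by simp)
    fun G hG env hv => by
      let e : Fin (d + d) → Fin G.1 := fun l => ⟨env (.inr (.inl l)), hv.1 _ (by simp)⟩
      refine ⟨⟨G.1, cut G.2 e⟩, hC.cut_mem hG e,
        code_eq (c := 0) (cut G.2 e) (fun u v => (cutFormula_iff (by simp) (by simp)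
          fun l => by simp [e]).symm) (fun _ l => l.elim0) fun l => l.elim0, ?_⟩
      refine ⟨fun h => ⟨e, fun _ => rfl, h⟩, fun ⟨e', he', h⟩ => ?_⟩
      obtain rfl : e = e' := funext fun l => Fin.ext (he' l).symm
      exact h
  refine bondagePoly_of_evaluable (hA.and hB.not) ?_ ?_
  · rintro G - env - e he ⟨h₁, h₂⟩
    by_contra h
    exact h₂ ⟨e, he, by lia⟩
  · rintro G - env - e he h₁ h₂
    refine ⟨h₁.le, ?_⟩
    rintro ⟨e', he', h⟩
    obtain rfl : e = e' := funext fun l => Fin.ext ((he l).trans (he' l).symm)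
    lia

theorem pendant_mem_hFree {W : Type} [Fintype W] {H : SimpleGraph W} [DecidableRel H.Adj]
    (hH : 2 ≤ H.minDegree) {G : FinGraph} (hG : G ∈ HFree H) {c : ℕ} (f : Fin c → Fin G.1) :
    (⟨G.1 + c, (pendant G.2 f).comap finSumFinEquiv.symm⟩ : FinGraph) ∈ HFree H := by
  intro h
  refine hG (isIndContained_of_pendant hH (f := f) ?_)
  obtain ⟨φ⟩ := h
  exact ⟨(SimpleGraph.Iso.comap finSumFinEquiv.symm (pendant G.2 f)).toEmbedding.comp φ⟩

theorem bondagePoly_hFree {W : Type} [Fintype W] {H : SimpleGraph W} [DecidableRel H.Adj]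
    (hH : 2 ≤ H.minDegree) (h : DominatingSetPoly (HFree H)) : BondagePoly d (HFree H) := by
  obtain ⟨M⟩ := h
  have hA := evaluable_dominationNumber_le (C := HFree H) (X := outer (d + d) (d + d))
    (φ := fun G env => dominationNumber G.2 ≤ env (.inl 0) + 1) M
    (emittable_graphCode (by simp) (by simp)) (x := .inl 0) (by simp)
    fun G hG env hv => ⟨G, hG, graphCode_eq G env, Iff.rfl⟩
  have hB := evaluable_dominationNumber_le (C := HFree H)
    (X := inner (d + d) (d + d) ∪ outer (d + d) (d + d))
    (φ := fun G env => ∃ f : Fin (d + d) → Fin G.1, (∀ l, (f l : ℕ) = env (.inr (.inr l))) ∧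
      dominationNumber (pendant G.2 f) ≤ env (.inl 0) + 1) M
    (emittable_code (c := d + d) (i := .inl 1) (j := .inl 2) (by simp) (by simp)
      (evaluable_adjFormula (a := .inl 1) (b := .inl 2) (by simp) (by simp))
      fun l => Evaluable.eq (x := .inl 1) (y := .inr (.inr l)) (by simp)) (x := .inl 0) (by simp)
    fun G hG env hv => by
      let f : Fin (d + d) → Fin G.1 := fun l => ⟨env (.inr (.inr l)), hv.1 _ (by simp)⟩
      refine ⟨_, pendant_mem_hFree hH hG f, code_eq _ (fun u v => ?_) (fun u l => ?_)
        fun l l' => ?_, ?_⟩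
      · rw [adjFormula_iff (u := u) (v := v) (by simp) (by simp)]
        simp [pendant]
      · simp [pendant, f, Fin.ext_iff]
      · simp [pendant]
      · rw [dominationNumber_congr (SimpleGraph.Iso.comap finSumFinEquiv.symm (pendant G.2 f))]
        refine ⟨fun h => ⟨f, fun _ => rfl, h⟩, fun ⟨f', hf', h⟩ => ?_⟩
        obtain rfl : f = f' := funext fun l => Fin.ext (hf' l).symm
        exact h
  -- The condition of `dominationNumber_cut_le_iff` that `f l` equals `e l` or is adjacent to it
  -- after the deletion.
  have hV := Evaluable.forall_mem (O := M.tm) (C := HFree H) (Q := {[]})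
    (X := inner (d + d) (d + d) ∪ outer (d + d) (d + d)) (List.finRange (d + d)) fun l _ =>
      (Evaluable.eq (x := .inr (.inr l)) (y := .inr (.inl l)) (by simp)).or
        (evaluable_cutFormula (a := .inr (.inl l)) (b := .inr (.inr l)) (by simp) (by simp))
  refine bondagePoly_of_evaluable
    (hA.and ((hV.and hB).exists_piecewise (disjoint_inner_outer _ _)).not) ?_ ?_
  · rintro G - env - e he ⟨h₁, h₂⟩
    by_contra h
    obtain ⟨f, hf, h⟩ := (dominationNumber_cut_le_iff e).1 ((not_lt.1 h).trans h₁)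
    refine h₂ ⟨Sum.elim 0 (Sum.elim 0 fun l => f l), ?_, fun l _ => ?_, f, ?_, ?_⟩
    · intro i hi
      obtain ⟨l, rfl⟩ := mem_inner.1 hi
      simp
    · rw [cutFormula_iff (u := e l) (v := f l) (e := e) (by simp [Finset.piecewise, he])
        (by simp [Finset.piecewise]) (by simp [Finset.piecewise, he])]
      simpa [Finset.piecewise, ← he, Fin.ext_iff] using hf l
    · simp [Finset.piecewise]
    · simpa [Finset.piecewise] using h
  · rintro G - env hv e he h₁ h₂
    refine ⟨h₁.le, ?_⟩
    rintro ⟨g, hg, hval, f, hf, h⟩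
    refine absurd ((dominationNumber_cut_le_iff e).2 ⟨f, fun l => ?_, h⟩) ?_
    · have := hval l (by simp)
      rw [cutFormula_iff (u := e l) (v := f l) (e := e) (by simp [Finset.piecewise, he])
        (hf l).symm (by simp [Finset.piecewise, he]), ← hf l] at this
      simpa [Finset.piecewise, ← he, Fin.ext_iff] using this
    · simp [Finset.piecewise]
      lia

/-- The tuple has the same length `K` for all `r`, so that one fixed set of variables serves every
bound; entries from `r` on are arbitrary padding. -/
theorem exists_tuple_iff {V : Type*} [Fintype V] [Nonempty V] {G : SimpleGraph V} {r K : ℕ}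
    (hr : r ≤ K) : (∃ f : Fin K → V, ∀ v, ∃ l : Fin K, (l : ℕ) < r ∧ (v = f l ∨ G.Adj v (f l))) ↔
      dominationNumber G ≤ r := by
  classical
  rw [dominationNumber_le_iff]
  constructor
  · rintro ⟨f, hf⟩
    refine ⟨Finset.univ.image fun l : Fin r => f (Fin.castLE hr l), fun v => ?_,
      Finset.card_image_le.trans (by simp)⟩
    obtain ⟨l, hl, h⟩ := hf v
    have hmem : f l ∈ Finset.univ.image fun l : Fin r => f (Fin.castLE hr l) :=
      Finset.mem_image.2 ⟨⟨l, hl⟩, Finset.mem_univ _, rfl⟩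
    rcases h with rfl | h
    exacts [.inl hmem, .inr ⟨_, hmem, h⟩]
  · rintro ⟨S, hS, hc⟩
    obtain ⟨t, ht⟩ := exists_range_eq hS.nonempty hc
    refine ⟨fun l => if h : (l : ℕ) < r then t ⟨l, h⟩ else Classical.arbitrary V, fun v => ?_⟩
    have key : ∀ u ∈ S, (v = u ∨ G.Adj v u) → ∃ l : Fin K, (l : ℕ) < r ∧
        (v = (if h : (l : ℕ) < r then t ⟨l, h⟩ else Classical.arbitrary V) ∨
          G.Adj v (if h : (l : ℕ) < r then t ⟨l, h⟩ else Classical.arbitrary V)) := by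
      intro u hu hvu
      obtain ⟨l, rfl⟩ : u ∈ Set.range t := ht ▸ hu
      exact ⟨Fin.castLE hr l, l.2, by simpa using hvu⟩
    rcases hS v with h | ⟨u, hu, h⟩
    exacts [key v h (.inl rfl), key u hu (.inr h)]

/-- The first `r` vertices of the second tuple form a dominating set for the adjacency given
by `ψ`. -/
def dominatedFormula (r : ℕ) (ψ : Vars (d + d) m → Vars (d + d) m → FinGraph →
    (Vars (d + d) m → ℕ) → Prop) (G : FinGraph) (env : Vars (d + d) m → ℕ) : Prop :=
  ∃ f : Vars (d + d) m → ℕ, (∀ i ∈ inner (d + d) m, f i < G.1) ∧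
    ¬ ∃ v < G.1, ¬ ∃ l ∈ List.finRange m, (l : ℕ) < r ∧
      (update ((inner (d + d) m).piecewise f env) (.inl 1) v (.inl 1) =
        update ((inner (d + d) m).piecewise f env) (.inl 1) v (.inr (.inr l)) ∨
      ψ (.inl 1) (.inr (.inr l)) G (update ((inner (d + d) m).piecewise f env) (.inl 1) v))

theorem evaluable_dominatedFormula {r : ℕ} {Q : Set (List Γ')} {ψ : Vars (d + d) m →
    Vars (d + d) m → FinGraph → (Vars (d + d) m → ℕ) → Prop}
    (hψ : ∀ X a b, a ∈ X → b ∈ X → Evaluable O C Q X (ψ a b)) :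
    Evaluable O C Q (outer (d + d) m) (dominatedFormula r ψ) :=
  Evaluable.exists_piecewise (disjoint_inner_outer _ _) (Evaluable.not (Evaluable.ex (x := .inl 1)
    (Evaluable.exists_mem (List.finRange m) fun l _ => (Evaluable.const ((l : ℕ) < r)).and
      ((Evaluable.eq (x := .inl 1) (y := .inr (.inr l)) (by simp)).or
        (hψ _ (.inl 1) (.inr (.inr l)) (by simp) (by simp)))).not (by simp)))

theorem dominatedFormula_iff {r : ℕ} (hr : r ≤ m) {ψ : Vars (d + d) m → Vars (d + d) m →
    FinGraph → (Vars (d + d) m → ℕ) → Prop} {G : FinGraph} [Nonempty (Fin G.1)]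
    {env : Vars (d + d) m → ℕ} {G' : SimpleGraph (Fin G.1)}
    (hψ : ∀ env' a b (u v : Fin G.1), (∀ l, env' (.inr (.inl l)) = env (.inr (.inl l))) →
      env' a = (u : ℕ) → env' b = (v : ℕ) → (ψ a b G env' ↔ G'.Adj u v)) :
    dominatedFormula r ψ G env ↔ dominationNumber G' ≤ r := by
  rw [← exists_tuple_iff hr]
  constructor
  · rintro ⟨f, hf, h⟩
    refine ⟨fun l => ⟨f (.inr (.inr l)), hf _ (by simp)⟩, fun v => ?_⟩
    by_contra hv
    refine h ⟨v, v.2, ?_⟩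
    rintro ⟨l, -, hl, h⟩
    refine hv ⟨l, hl, ?_⟩
    rw [hψ _ _ _ v ⟨f (.inr (.inr l)), hf _ (by simp)⟩ (by simp [Finset.piecewise]) (by simp)
      (by simp [Finset.piecewise])] at h
    simpa [Finset.piecewise, Fin.ext_iff] using h
  · rintro ⟨f, hf⟩
    refine ⟨Sum.elim 0 (Sum.elim 0 fun l => f l), ?_, ?_⟩
    · intro i hi
      obtain ⟨l, rfl⟩ := mem_inner.1 hi
      simp
    · rintro ⟨v, hv, h⟩
      obtain ⟨l, hl, hvl⟩ := hf ⟨v, hv⟩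
      refine h ⟨l, by simp, hl, ?_⟩
      rw [hψ _ _ _ ⟨v, hv⟩ (f l) (by simp [Finset.piecewise]) (by simp)
        (by simp [Finset.piecewise])]
      simpa [Finset.piecewise, Fin.ext_iff] using hvl

theorem bondagePoly_of_dominationNumber_le {K : ℕ} (h : ∀ G ∈ C, dominationNumber G.2 ≤ K) :
    BondagePoly d C := by
  -- No queries are asked, so any machine can serve as oracle. Since `γ(G) ≤ K`, the separating
  -- integer `r` is taken from a constant list, and the bound variable for it plays no role.
  refine bondagePoly_of_evaluable (O := idComputer Bool) (m := K)
    (Evaluable.exists_mem (List.range (K + 1)) fun r _ =>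
      (evaluable_dominatedFormula (r := r) (ψ := adjFormula) fun X a b =>
        evaluable_adjFormula).and
      (evaluable_dominatedFormula (r := r) (ψ := cutFormula) fun X a b =>
        evaluable_cutFormula).not) ?_ ?_
  all_goals
    intro G hG env hv e he
    -- That the integer variable has a value below `n` shows that the graph has a vertex.
    have hne : Nonempty (Fin G.1) := ⟨env (.inl 0), hv.1 _ (by simp)⟩
    have h₁ : ∀ r ≤ K, dominatedFormula r adjFormula G env ↔ dominationNumber G.2 ≤ r :=
      fun r hr => dominatedFormula_iff hr fun env' a b u v _ => adjFormula_iff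
    have h₂ : ∀ r ≤ K, dominatedFormula r cutFormula G env ↔ dominationNumber (cut G.2 e) ≤ r :=
      fun r hr => dominatedFormula_iff hr fun env' a b u v he' hu hv =>
        cutFormula_iff hu hv fun l => by rw [he, he']
  · rintro ⟨r, hr, hr₁, hr₂⟩
    have hr' : r ≤ K := by simpa [Nat.lt_succ_iff] using hr
    rw [h₁ r hr'] at hr₁
    rw [h₂ r hr'] at hr₂
    lia
  · intro _ hlt
    refine ⟨dominationNumber G.2, by simpa [Nat.lt_succ_iff] using h G hG,
      (h₁ _ (h G hG)).2 le_rfl, ?_⟩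
    rw [h₂ _ (h G hG)]
    lia

end Cases

end Bondage

theorem mainTheorem6 (d : ℕ) (hd : 1 ≤ d) :
    (∀ C : Set Bondage.FinGraph, Bondage.ClosedUnderEdgeDeletions C →
      Bondage.DominatingSetPoly C → Bondage.BondagePoly d C) ∧
    (∀ (W : Type) [Fintype W] (H : SimpleGraph W) [DecidableRel H.Adj], 2 ≤ H.minDegree →
      Bondage.DominatingSetPoly (Bondage.HFree H) → Bondage.BondagePoly d (Bondage.HFree H)) ∧
    (∀ (C : Set Bondage.FinGraph) (k : ℕ),
      (∀ G ∈ C, Bondage.dominationNumber G.2 ≤ k) → Bondage.BondagePoly d C) :=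
  ⟨fun _ => Bondage.bondagePoly_of_closedUnderEdgeDeletions,
    fun _ _ _ _ => Bondage.bondagePoly_hFree,
    fun _ _ => Bondage.bondagePoly_of_dominationNumber_le⟩
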